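/- **Proposition 3.1.** Let $a,b\ge 0$ be integers, $m=b-a-1$, $n=(a+2)(b+1)$, and let $$M=A_{m,n}=\begin{pmatrix}0&1&0\\0&0&1\\1&-m&-n\end{pmatrix}\in SL(3,\mathbb Z).$$ The characteristic polynomial of $M$ is irreducible over $\mathbb Q$ and has three distinct real roots. Consider the three planes in $\mathbb R^3$ spanned by pairs of linearly independent eigenvectors of $M$. The connected components of the complement of their union are called open orthants. The sail of an open orthant $O$ is the boundary of the convex hull of all nonzero integer points in the closure of $O$; its vertices, edges and triangles are the proper faces of this convex hull of dimension $0$, $1$, $2$. There is exactly one open orthant $O$ for which this convex hull contains $(0,0,1)$. Let $S$ be its sail and let $\Xi$ be the group of all $g\in SL(3,\mathbb Z)$ with $gM=Mg$ and $g(S)=S$. Put $$A=(1,0,a+2),\quad B=(0,0,1),\quad C=(b-a-1,1,0),\quad D=((b+1)^2,b+1,1),$$ $$X=M^{-2},\qquad Y=M^{-1}\bigl(M^{-1}-(b+1)I\bigr).$$ Then the following holds. 1. (Torus triangulation.) Decompose the factor space $S/\Xi$ into the images of the faces of $S$. There is a homeomorphism of $S/\Xi$ onto the torus $\mathbb R^2/\mathbb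 Z^2$ that carries this decomposition, dimension by dimension, to the following one, obtained from a square $ABCD$ cut by the diagonal $BD$ by gluing its opposite sides by translations ($AB$ to $DC$ and $AD$ to $BC$): one vertex, three edges (the images of $AB$, $AD$, $BD$), and two triangles $ABD$ and $BCD$. 2. (Period group.) $X,Y\in SL(3,\mathbb Z)$, and $\Xi$ is the free abelian group of rank two with the generators $X$ and $Y$. Moreover $X(A)=D$, $X(B)=C$, $Y(A)=B$, $Y(D)=C$. 3. (Fundamental region.) $A,B,C,D$ are vertices of $S$. The vertex $B$, the edges $AB$, $AD$, $BD$ and the triangles $ABD$, $BCD$ are faces of $S$, and every face of $S$ is equivalent under $\Xi$ to exactly one of these six faces. Hence the union of these six faces, taken relatively open, is a fundamental region of $S$; its closure is the union of the closed triangles $ABD$ and $BCD$. 4. (Integer invariants.) The integer points strictly inside the segment $BD$ are exactly $((b+1)i,\,i,\,1)$, $1\le i\le b$. The integer lengths of $AB$, $BC$, $CD$, $DA$, $BD$ are $1,1,1,1,b+1$. The integer areas of the triangles $ABD$ and $BCD$ both equal $b+1$. The integer distances from the origin to the planes $ABD$ and $BCD$ equal $1$ and $a+2$ respectively. Here the integer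 length (area) of an integer segment (triangle) is the ratio of its Euclidean length (area) to the minimal Euclidean length (area) of a nondegenerate segment (triangle) with integer vertices in the same line (plane). The integer distance from an integer plane to an integer point is the ratio of the Euclidean distance between them to the minimal Euclidean distance from the plane to an integer point outside it. -/

import Mathlib

open MeasureTheory
open scoped MatrixGroups

noncomputable section

namespace KleinPolyhedron

/-- Three-dimensional Euclidean space. -/
abbrev Space : Type := EuclideanSpace ℝ (Fin 3)

/-- Integer points: all the coordinates are integers. -/
def IsIntegerPoint (x : Space) : Prop := ∀ i, ∃ k : ℤ, x i = k

/-- The operator of `SL(3, ℤ)` acting on space by its matrix (on column vectors). -/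
def toOperator (g : SL(3, ℤ)) : Space →ₗ[ℝ] Space :=
  Matrix.toEuclideanLin ((g : Matrix (Fin 3) (Fin 3) ℤ).map (Int.cast : ℤ → ℝ))

/-- The Frobenius operator with parameters `m`, `n`. -/
def frobeniusOperator (m n : ℤ) : SL(3, ℤ) :=
  ⟨!![0, 1, 0; 0, 0, 1; 1, -m, -n], by simp [Matrix.det_fin_three]⟩

/-! ### Orthants and sails -/

/-- A vector that is an eigenvector of the operator `M`, for some real eigenvalue. -/
def IsEigenvector (M : SL(3, ℤ)) (v : Space) : Prop :=
  ∃ μ : ℝ, Module.End.HasEigenvector (toOperator M) μ v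

/-- The planes spanned by pairs of linearly independent eigenvectors of `M`. -/
def eigenplanes (M : SL(3, ℤ)) : Set (Submodule ℝ Space) :=
  {H | ∃ u v : Space, IsEigenvector M u ∧ IsEigenvector M v ∧
    LinearIndependent ℝ ![u, v] ∧ H = Submodule.span ℝ {u, v}}

/-- The complement to the union of these planes. -/
def planesComplement (M : SL(3, ℤ)) : Set Space :=
  {x | ∀ H ∈ eigenplanes M, x ∉ H}

/-- The open orthants of `M`: the connected components of the complement to the planes. -/
def IsOrthant (M : SL(3, ℤ)) (O : Set Space) : Prop :=
  ∃ x ∈ planesComplement M, O = connectedComponentIn (planesComplement M) x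

/-- The convex hull of all the nonzero integer points in the closure of the orthant `O`. -/
def integerHull (O : Set Space) : Set Space :=
  convexHull ℝ {x | x ∈ closure O ∧ IsIntegerPoint x ∧ x ≠ 0}

/-- The sail of the orthant `O`: the boundary of this convex hull. -/
def sail (O : Set Space) : Set Space := frontier (integerHull O)

/-- `F` is a (closed) `k`-dimensional face of the sail of `O`: a nonempty proper face of the
convex hull, that is, its set of contact with a supporting plane, of dimension `k`. -/
def IsFace (O : Set Space) (k : ℕ) (F : Set Space) : Prop :=
  F.Nonempty ∧ F ≠ integerHull O ∧ IsExposed ℝ (integerHull O) F ∧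
    Module.finrank ℝ (vectorSpan ℝ F) = k

/-! ### The period group, the torus and its triangulation -/

/-- The group of the integer operators of determinant one that commute with `M` and map the
sail of `O` to itself. -/
def periodGroup (M : SL(3, ℤ)) (O : Set Space) : Subgroup SL(3, ℤ) where
  carrier := {g | g * M = M * g ∧ toOperator g '' sail O = sail O}
  one_mem' := by
    refine ⟨by simp, ?_⟩
    have h : toOperator 1 = LinearMap.id := by
      ext x i
      simp [toOperator]
    simp [h]
  mul_mem' := by
    rintro g h ⟨hg, hg'⟩ ⟨hh, hh'⟩
    refine ⟨by rw [mul_assoc, hh, ← mul_assoc, hg, mul_assoc], ?_⟩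
    have e : toOperator (g * h) = toOperator g ∘ₗ toOperator h := by
      ext x i
      simp [toOperator, Matrix.toLpLin_apply, Matrix.map_mul_intCast]
    rw [e, LinearMap.coe_comp, Set.image_comp, hh', hg']
  inv_mem' := by
    rintro g ⟨hg, hg'⟩
    refine ⟨by rw [inv_mul_eq_iff_eq_mul, ← mul_assoc, hg, mul_assoc, mul_inv_cancel, mul_one], ?_⟩
    have e : ∀ x, toOperator g⁻¹ (toOperator g x) = x := by
      intro x
      have e1 : toOperator (g⁻¹ * g) = toOperator g⁻¹ ∘ₗ toOperator g := by
        ext x i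
        simp only [toOperator, Matrix.SpecialLinearGroup.coe_mul, Matrix.map_mul_intCast,
          Matrix.toLpLin_apply, LinearMap.comp_apply, Matrix.mulVec_mulVec]
      have e2 : toOperator (g⁻¹ * g) = LinearMap.id := by
        ext x i
        simp [toOperator]
      rw [← LinearMap.comp_apply, ← e1, e2, LinearMap.id_apply]
    conv_lhs => rw [← hg']
    rw [← Set.image_comp]
    convert Set.image_id _
    exact funext e

/-- Two points of the sail are equivalent if an element of the period group maps one to the
other. -/
def periodSetoid (M : SL(3, ℤ)) (O : Set Space) : Setoid (sail O) where
  r x y := ∃ g ∈ periodGroup M O, toOperator g x = y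
  iseqv := by
    have one : ∀ x, toOperator 1 x = x := fun x => by
      have : toOperator 1 = LinearMap.id := by
        ext x i
        simp [toOperator]
      rw [this, LinearMap.id_apply]
    have mul : ∀ g h x, toOperator (g * h) x = toOperator g (toOperator h x) := fun g h x => by
      simp only [toOperator, Matrix.SpecialLinearGroup.coe_mul, Matrix.map_mul_intCast,
          Matrix.toLpLin_apply, Matrix.mulVec_mulVec]
    refine ⟨fun x => ⟨1, one_mem _, one _⟩, ?_, ?_⟩
    · rintro x y ⟨g, hg, h⟩
      exact ⟨g⁻¹, inv_mem hg, by rw [← h, ← mul, inv_mul_cancel, one]⟩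
    · rintro x y z ⟨g, hg, h⟩ ⟨g', hg', h'⟩
      exact ⟨g' * g, mul_mem hg' hg, by rw [mul, h, h']⟩

/-- The factor of the sail under the action of the period group, with the quotient topology. -/
abbrev SailFactor (M : SL(3, ℤ)) (O : Set Space) : Type := Quotient (periodSetoid M O)

/-- The torus triangulation: the decomposition of the factor into the images of the faces of the
sail; `torusTriangulation M O k` is the family of the (closed) `k`-dimensional cells. -/
def torusTriangulation (M : SL(3, ℤ)) (O : Set Space) (k : ℕ) : Set (Set (SailFactor M O)) :=
  {c | ∃ F, IsFace O k F ∧ c = Quotient.mk (periodSetoid M O) '' (Subtype.val ⁻¹' F)}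

/-- Two decompositions of topological spaces into cells are homeomorphic: some homeomorphism of
the spaces carries the `k`-dimensional cells of the one to those of the other, for all `k`. -/
def HomeomorphicDecompositions {S T : Type} [TopologicalSpace S] [TopologicalSpace T]
    (c : ℕ → Set (Set S)) (d : ℕ → Set (Set T)) : Prop :=
  ∃ φ : S ≃ₜ T, ∀ k, (fun s => φ '' s) '' c k = d k

/-- The projection of the plane to the torus `(ℝ/ℤ)²`. -/
def toTorus (p : ℝ × ℝ) : UnitAddCircle × UnitAddCircle := (p.1, p.2)

/-- The model: the square with vertices `B = (0, 0)`, `C = (1, 0)`, `D = (1, 1)`, `A = (0, 1)`,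
cut by its diagonal `BD` into the triangles `ABD` and `BCD`, its opposite sides being glued by
translations. It has one vertex, three edges and two triangles. -/
def squareTriangulation : ℕ → Set (Set (UnitAddCircle × UnitAddCircle))
  | 0 => {toTorus '' {(0, 0)}}
  | 1 => {toTorus '' segment ℝ (0, 0) (1, 0), toTorus '' segment ℝ (0, 0) (0, 1),
      toTorus '' segment ℝ (0, 0) (1, 1)}
  | 2 => {toTorus '' convexHull ℝ {(0, 1), (0, 0), (1, 1)},
      toTorus '' convexHull ℝ {(0, 0), (1, 0), (1, 1)}}
  | _ => ∅

/-- A family of faces of the sail that contains exactly one face from each equivalence class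
under the period group. -/
def IsFundamentalFamily (M : SL(3, ℤ)) (O : Set Space) (𝓕 : Set (Set Space)) : Prop :=
  (∀ F ∈ 𝓕, ∃ k, IsFace O k F) ∧
    ∀ k F, IsFace O k F → ∃! F', F' ∈ 𝓕 ∧ ∃ g ∈ periodGroup M O, toOperator g '' F = F'

/-- The union of the faces of the family. The faces are taken relatively open here, so that
different faces are disjoint. -/
def openFaceUnion (𝓕 : Set (Set Space)) : Set Space :=
  ⋃ F ∈ 𝓕, intrinsicInterior ℝ F

/-- A fundamental region of the sail: a union of faces that contains exactly one face from each
equivalence class. -/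
def IsFundamentalRegion (M : SL(3, ℤ)) (O : Set Space) (R : Set Space) : Prop :=
  ∃ 𝓕, IsFundamentalFamily M O 𝓕 ∧ R = openFaceUnion 𝓕

/-! ### Integer lengths, areas and distances -/

/-- The Euclidean `k`-dimensional volume. -/
def euclideanVolume (k : ℕ) (P : Set Space) : ℝ := (μHE[k] P).toReal

/-- The integer `k`-dimensional volume of the `k`-dimensional integer polyhedron `P`: the ratio
of its Euclidean volume to the minimal Euclidean volume of a `k`-dimensional simplex with integer
vertices in the same `k`-dimensional affine subspace. -/
def integerVolume (k : ℕ) (P : Set Space) : ℝ :=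
  euclideanVolume k P /
    sInf {V | ∃ w : Fin (k + 1) → Space, AffineIndependent ℝ w ∧
      (∀ i, IsIntegerPoint (w i) ∧ w i ∈ affineSpan ℝ P) ∧
      V = euclideanVolume k (convexHull ℝ (Set.range w))}

/-- The integer length of the segment `PQ`. -/
def integerLength (P Q : Space) : ℝ := integerVolume 1 (segment ℝ P Q)

/-- The integer area of the triangle `PQR`. -/
def integerArea (P Q R : Space) : ℝ := integerVolume 2 (convexHull ℝ {P, Q, R})

/-- The integer distance from the integer plane `H` to the integer point `p`: the ratio of the
Euclidean distance to the minimal Euclidean distance from `H` to an integer point outside `H`. -/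
def integerDistance (H : AffineSubspace ℝ Space) (p : Space) : ℝ :=
  Metric.infDist p (H : Set Space) /
    sInf {d | ∃ q, IsIntegerPoint q ∧ q ∉ H ∧ d = Metric.infDist q (H : Set Space)}

end KleinPolyhedron

end

open KleinPolyhedron

/-!
Identify `ℤ³` with the order `ℤ[t]`, where `t (t + a + 2) (t - b - 1) = 1`, so that `M⁻¹` is the
multiplication by `t` and `B` is `1`. Then `X = t²`, `Y = (t + a + 2)⁻¹`, and the points `A`, `B`,
`C`, `D` are the units `t + a + 2`, `1`, `t²`, `t² (t + a + 2)`. So the translates of the triangles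
`ABD` and `BCD` by the units `X ^ i * Y ^ j` are combinatorially the triangulated plane. At each
edge the two adjacent triangles bend towards the origin. Over the translates, the smallest value at
a point of the orthant of the linear forms equal to `1` on the triangles is attained, as the units
with bounded conjugates are finite in number, and local convexity puts the point in the cone over
the triangle where it is attained. Hence every integer point lies on or above all these planes, the
translates are the faces of the sail, and the period group, which permutes the vertices, consists
of the units `X ^ i * Y ^ j`. The sail is compared with the plane through barycentric coordinates.
-/

noncomputable section

namespace KleinPolyhedron

/-! ### General facts -/

lemma sum_smul_of_biorthogonal {K E ι : Type*} [Field K] [AddCommGroup E] [Module K E]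
    [FiniteDimensional K E] [Fintype ι] [DecidableEq ι] {f : ι → E →ₗ[K] K} {e : ι → E}
    (hfe : ∀ i j, f i (e j) = if i = j then 1 else 0)
    (hcard : Fintype.card ι = Module.finrank K E) (v : E) : ∑ i, f i v • e i = v := by
  have he : LinearIndependent K e := by
    rw [Fintype.linearIndependent_iff]
    intro c hc i
    simpa [hfe] using congr_arg (f i) hc
  have hv : v ∈ Submodule.span K (Set.range e) := by
    rw [he.span_eq_top_of_card_eq_finrank' hcard]
    exact Submodule.mem_top
  obtain ⟨c, rfl⟩ := Submodule.mem_span_range_iff_exists_fun K |>.1 hv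
  simp [hfe]

lemma exists_homeomorph_of_fibres {X Y Z : Type*} [TopologicalSpace X] [TopologicalSpace Y]
    [TopologicalSpace Z] [CompactSpace X] [T2Space Y] [T2Space Z] {f : X → Y} {g : X → Z}
    (hf : Continuous f) (hg : Continuous g) (sf : f.Surjective) (sg : g.Surjective)
    (h : ∀ x y, f x = f y ↔ g x = g y) : ∃ φ : Y ≃ₜ Z, ∀ x, φ (f x) = g x := by
  have hgf (x : X) : g (Function.surjInv sf (f x)) = g x :=
    (h _ _).1 (Function.surjInv_eq sf _)
  have hfg (x : X) : f (Function.surjInv sg (g x)) = f x :=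
    (h _ _).2 (Function.surjInv_eq sg _)
  have qf := hf.isClosedMap.isQuotientMap hf sf
  have qg := hg.isClosedMap.isQuotientMap hg sg
  refine ⟨⟨⟨fun y => g (Function.surjInv sf y), fun z => f (Function.surjInv sg z),
    sf.forall.2 fun x => ?_, sg.forall.2 fun x => ?_⟩, ?_, ?_⟩, hgf⟩
  · simp only [hgf, hfg]
  · simp only [hgf, hfg]
  · exact qf.continuous_iff.2 (hg.congr fun x => (hgf x).symm)
  · exact qg.continuous_iff.2 (hf.congr fun x => (hfg x).symm)

lemma convexHull_image_single_subset_stdSimplex {ι : Type*} [Fintype ι] [DecidableEq ι]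
    (J : Set ι) : convexHull ℝ ((fun i => Pi.single i (1 : ℝ)) '' J) ⊆ stdSimplex ℝ ι := by
  rw [← convexHull_rangle_single_eq_stdSimplex]
  exact convexHull_mono (Set.image_subset_range _ _)

lemma subset_closure_intrinsicInterior {V : Type*} [NormedAddCommGroup V] [NormedSpace ℝ V]
    [FiniteDimensional ℝ V] {s : Set V} (hs : Convex ℝ s) :
    s ⊆ closure (intrinsicInterior ℝ s) := by
  intro y hy
  have : Nonempty (affineSpan ℝ s) := ⟨⟨y, subset_affineSpan ℝ s hy⟩⟩
  let φ := AffineIsometryEquiv.vaddConst ℝ (⟨y, subset_affineSpan ℝ s hy⟩ : affineSpan ℝ s)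
  let ψ : (affineSpan ℝ s).direction → V := fun v => φ v
  have hψ : Continuous ψ := continuous_subtype_val.comp φ.continuous
  have hinterior : ψ '' interior (ψ ⁻¹' s) = intrinsicInterior ℝ s := by
    change (Subtype.val ∘ φ.toHomeomorph) '' interior (φ.toHomeomorph ⁻¹' (Subtype.val ⁻¹' s)) = _
    rw [← φ.toHomeomorph.preimage_interior, Set.image_comp, φ.toHomeomorph.image_preimage,
      intrinsicInterior]
  have hne : (interior (ψ ⁻¹' s)).Nonempty := by
    rw [← Set.image_nonempty (f := ψ), hinterior]
    exact Set.Nonempty.intrinsicInterior hs ⟨y, hy⟩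
  have hconvex : Convex ℝ (ψ ⁻¹' s) := hs.affine_preimage
    ((affineSpan ℝ s).subtype.comp φ.toAffineEquiv.toAffineMap)
  have h0 : ψ 0 = y := by simp [ψ, φ]
  have hmem : (0 : (affineSpan ℝ s).direction) ∈ closure (interior (ψ ⁻¹' s)) := by
    rw [hconvex.closure_interior_eq_closure_of_nonempty_interior hne]
    exact subset_closure (by rwa [Set.mem_preimage, h0])
  rw [← hinterior, ← h0]
  exact image_closure_subset_closure_image hψ ⟨0, hmem, rfl⟩

lemma infDist_eq_abs_inner_sub_div_norm {E : Type*} [NormedAddCommGroup E] [InnerProductSpace ℝ E]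
    {H : Set E} {n : E} {c : ℝ} (hn : n ≠ 0) (hH : ∀ v, v ∈ H ↔ inner ℝ n v = c) (q : E) :
    Metric.infDist q H = |inner ℝ n q - c| / ‖n‖ := by
  have hpos : 0 < ‖n‖ := norm_pos_iff.2 hn
  set t := (inner ℝ n q - c) / ‖n‖ ^ 2 with ht
  have hfoot : q - t • n ∈ H := by
    rw [hH, inner_sub_right, inner_smul_right, real_inner_self_eq_norm_sq, ht,
      div_mul_cancel₀ _ (pow_pos hpos 2).ne', sub_sub_cancel]
  apply le_antisymm
  · refine (Metric.infDist_le_dist_of_mem hfoot).trans_eq ?_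
    rw [dist_eq_norm, sub_sub_cancel, norm_smul, ht, norm_div, Real.norm_eq_abs, norm_pow,
      norm_norm]
    field_simp
  · refine (Metric.le_infDist ⟨_, hfoot⟩).2 fun p hp => ?_
    rw [div_le_iff₀' hpos, dist_eq_norm, ← (hH p).1 hp, ← inner_sub_right]
    exact abs_real_inner_le_norm _ _

lemma affineIndependent_iff_linearIndependent_sub {K V : Type*} [Ring K] [AddCommGroup V]
    [Module K V] {k : ℕ} (w : Fin (k + 1) → V) :
    AffineIndependent K w ↔ LinearIndependent K fun i : Fin k => w i.succ - w 0 := by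
  rw [affineIndependent_iff_linearIndependent_vsub K w 0,
    ← linearIndependent_equiv (finSuccAboveEquiv 0)]
  rfl

/-! ### Integer operators -/

lemma toOperator_apply (g : SL(3, ℤ)) (v : Space) (i : Fin 3) :
    toOperator g v i = g i 0 * v 0 + g i 1 * v 1 + g i 2 * v 2 := by
  simp [toOperator, Matrix.toLpLin_apply, Matrix.mulVec, dotProduct, Fin.sum_univ_three]

lemma toOperator_one (v : Space) : toOperator 1 v = v := by
  simp [toOperator]

lemma toOperator_mul (g h : SL(3, ℤ)) (v : Space) :
    toOperator (g * h) v = toOperator g (toOperator h v) := by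
  simp only [toOperator, Matrix.SpecialLinearGroup.coe_mul, Matrix.map_mul_intCast,
    Matrix.toLpLin_apply, Matrix.mulVec_mulVec]

lemma toOperator_inv_apply_self (g : SL(3, ℤ)) (v : Space) :
    toOperator g⁻¹ (toOperator g v) = v := by
  rw [← toOperator_mul, inv_mul_cancel, toOperator_one]

lemma toOperator_apply_inv_self (g : SL(3, ℤ)) (v : Space) :
    toOperator g (toOperator g⁻¹ v) = v := by
  rw [← toOperator_mul, mul_inv_cancel, toOperator_one]

lemma toOperator_inv_apply_eq_iff {g : SL(3, ℤ)} {v w : Space} :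
    toOperator g⁻¹ v = w ↔ v = toOperator g w :=
  ⟨fun h => by rw [← h, toOperator_apply_inv_self],
    fun h => by rw [h, toOperator_inv_apply_self]⟩

lemma toOperator_injective : Function.Injective toOperator := fun g h e => by
  ext i j
  have := congr_fun (congr_arg WithLp.ofLp (LinearMap.congr_fun e (EuclideanSpace.single j 1))) i
  rw [toOperator_apply, toOperator_apply] at this
  fin_cases j <;> simpa using this

lemma IsIntegerPoint.map {v : Space} (hv : IsIntegerPoint v) (g : SL(3, ℤ)) :
    IsIntegerPoint (toOperator g v) := by
  choose k hk using hv
  intro i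
  refine ⟨g i 0 * k 0 + g i 1 * k 1 + g i 2 * k 2, ?_⟩
  simp only [toOperator_apply, hk]
  push_cast
  rfl

lemma IsIntegerPoint.add {v w : Space} (hv : IsIntegerPoint v) (hw : IsIntegerPoint w) :
    IsIntegerPoint (v + w) := fun i => by
  obtain ⟨⟨p, hp⟩, ⟨q, hq⟩⟩ := And.intro (hv i) (hw i)
  exact ⟨p + q, by simp [hp, hq]⟩

lemma IsIntegerPoint.smul {v : Space} (hv : IsIntegerPoint v) (n : ℤ) :
    IsIntegerPoint ((n : ℝ) • v) := fun i => by
  obtain ⟨p, hp⟩ := hv i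
  exact ⟨n * p, by simp [hp]⟩

lemma IsIntegerPoint.sub {v w : Space} (hv : IsIntegerPoint v) (hw : IsIntegerPoint w) :
    IsIntegerPoint (v - w) := by
  simpa [sub_eq_add_neg] using hv.add (hw.smul (-1))

lemma space_ext {v w : Space} (h0 : v 0 = w 0) (h1 : v 1 = w 1) (h2 : v 2 = w 2) : v = w := by
  ext i
  fin_cases i <;> assumption

/-- The linear form with the coefficients `x`, `y`, `z`. -/
def linForm (x y z : ℝ) : Space →ₗ[ℝ] ℝ :=
  x • EuclideanSpace.projₗ 0 + y • EuclideanSpace.projₗ 1 + z • EuclideanSpace.projₗ 2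

lemma linForm_apply (x y z : ℝ) (v : Space) : linForm x y z v = x * v 0 + y * v 1 + z * v 2 := by
  simp [linForm]

/-! ### The units -/

section Units

variable (a b : ℕ)

/-- The operator `M` of the proposition. -/
def frob : SL(3, ℤ) := frobeniusOperator (b - a - 1) ((a + 2) * (b + 1))

/-- The generator `X` of the period group. -/
def unitX : SL(3, ℤ) := (frob a b)⁻¹ ^ 2

/-- The generator `Y = M⁻¹ (M⁻¹ - (b + 1))` of the period group, multiplied out. -/
def unitY : SL(3, ℤ) :=
  ⟨!![((a : ℤ) + 2) ^ 2, 1 - ((a : ℤ) + 2) ^ 2 * (b + 1), -((a : ℤ) + 2);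
    -((a : ℤ) + 2), ((a : ℤ) + 2) * (b + 1), 1; 1, -((b : ℤ) + 1), 0], by
    simp [Matrix.det_fin_three]; ring⟩

/-- The elements of the period group. The inverse of `Y` makes the vertex `A` the image of `B`
under `unit (0, 1)`, as it is in the model square. -/
def unit (κ : ℤ × ℤ) : SL(3, ℤ) := unitX a b ^ κ.1 * (unitY a b)⁻¹ ^ κ.2

/-- The vertex `A`. -/
def ptA : Space := !₂[1, 0, (a : ℝ) + 2]

/-- The vertex `B`. -/
def ptB : Space := !₂[0, 0, 1]

/-- The vertex `C`. -/
def ptC : Space := !₂[(b : ℝ) - a - 1, 1, 0]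

/-- The vertex `D`. -/
def ptD : Space := !₂[((b : ℝ) + 1) ^ 2, (b : ℝ) + 1, 1]

/-- The vertices of the sail. -/
def vert (κ : ℤ × ℤ) : Space := toOperator (unit a b κ) ptB

variable {a b}

lemma frob_apply (v : Space) : toOperator (frob a b) v =
    !₂[v 1, v 2, v 0 - ((b : ℝ) - a - 1) * v 1 - (a + 2) * (b + 1) * v 2] := by
  apply space_ext <;> rw [toOperator_apply] <;> simp [frob, frobeniusOperator]
  ring

lemma frob_inv_coe : (((frob a b)⁻¹ : SL(3, ℤ)) : Matrix (Fin 3) (Fin 3) ℤ) =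
    !![(b : ℤ) - a - 1, (a + 2) * (b + 1), 1; 1, 0, 0; 0, 1, 0] := by
  rw [Matrix.SpecialLinearGroup.coe_inv, frob, frobeniusOperator, Matrix.adjugate_fin_three_of]
  simp

lemma frob_inv_apply (v : Space) : toOperator (frob a b)⁻¹ v =
    !₂[((b : ℝ) - a - 1) * v 0 + (a + 2) * (b + 1) * v 1 + v 2, v 0, v 1] := by
  rw [toOperator_inv_apply_eq_iff, frob_apply]
  apply space_ext <;> simp
  ring

lemma unitY_coe : (unitY a b : Matrix (Fin 3) (Fin 3) ℤ) =
    ((frob a b)⁻¹ : SL(3, ℤ)) *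
      ((((frob a b)⁻¹ : SL(3, ℤ)) : Matrix (Fin 3) (Fin 3) ℤ) - ((b : ℤ) + 1) • 1) := by
  ext i j
  rw [frob_inv_coe, Matrix.mul_apply, Fin.sum_univ_three]
  simp only [Matrix.sub_apply, Matrix.smul_apply]
  fin_cases i <;> fin_cases j <;> simp [unitY, Matrix.one_apply] <;> ring

lemma unitX_apply (v : Space) : toOperator (unitX a b) v =
    !₂[(((b : ℝ) - a - 1) ^ 2 + (a + 2) * (b + 1)) * v 0 +
        (((b : ℝ) - a - 1) * ((a + 2) * (b + 1)) + 1) * v 1 + ((b : ℝ) - a - 1) * v 2,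
      ((b : ℝ) - a - 1) * v 0 + (a + 2) * (b + 1) * v 1 + v 2, v 0] := by
  rw [unitX, pow_two, toOperator_mul, frob_inv_apply, frob_inv_apply]
  apply space_ext <;> simp
  ring

lemma unitX_inv_apply (v : Space) : toOperator (unitX a b)⁻¹ v =
    !₂[v 2, v 0 - ((b : ℝ) - a - 1) * v 1 - (a + 2) * (b + 1) * v 2,
      v 1 - ((b : ℝ) - a - 1) * v 2 - (a + 2) * (b + 1) *
        (v 0 - ((b : ℝ) - a - 1) * v 1 - (a + 2) * (b + 1) * v 2)] := by
  rw [unitX, inv_pow, inv_inv, pow_two, toOperator_mul, frob_apply, frob_apply]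
  apply space_ext <;> simp

lemma unitY_apply (v : Space) : toOperator (unitY a b) v =
    !₂[((a : ℝ) + 2) ^ 2 * v 0 + (1 - ((a : ℝ) + 2) ^ 2 * (b + 1)) * v 1 - ((a : ℝ) + 2) * v 2,
      -((a : ℝ) + 2) * v 0 + (a + 2) * (b + 1) * v 1 + v 2, v 0 - ((b : ℝ) + 1) * v 1] := by
  apply space_ext <;> rw [toOperator_apply] <;> simp [unitY] <;> ring

lemma unitY_inv_apply (v : Space) : toOperator (unitY a b)⁻¹ v =
    !₂[((b : ℝ) + 1) * v 0 + (a + 2) * (b + 1) * v 1 + v 2, v 0 + ((a : ℝ) + 2) * v 1,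
      v 1 + ((a : ℝ) + 2) * v 2] := by
  rw [toOperator_inv_apply_eq_iff, unitY_apply]
  apply space_ext <;> simp <;> ring

lemma commute_unitX_frob : Commute (unitX a b) (frob a b) :=
  ((Commute.refl (frob a b)).inv_left.pow_left 2)

lemma commute_unitY_frob : Commute (unitY a b) (frob a b) := by
  refine (Commute.inv_left_iff).1 (toOperator_injective (LinearMap.ext fun v => ?_))
  simp only [toOperator_mul, frob_apply, unitY_inv_apply]
  apply space_ext <;> simp <;> ring

lemma commute_unitX_unitY : Commute (unitX a b) (unitY a b) :=
  (commute_unitY_frob.inv_right.pow_right 2).symm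

lemma commute_unit_frob (κ : ℤ × ℤ) : Commute (unit a b κ) (frob a b) :=
  (commute_unitX_frob.zpow_left _).mul_left (commute_unitY_frob.inv_left.zpow_left _)

lemma unit_zero : unit a b 0 = 1 := by simp [unit]

lemma unit_add (κ l : ℤ × ℤ) : unit a b (κ + l) = unit a b κ * unit a b l := by
  have h : Commute ((unitY a b)⁻¹ ^ κ.2) (unitX a b ^ l.1) :=
    commute_unitX_unitY.symm.inv_left.zpow_zpow _ _
  simp only [unit, Prod.fst_add, Prod.snd_add, zpow_add]
  rw [mul_assoc, mul_assoc, ← mul_assoc (unitX a b ^ l.1), ← h.eq, mul_assoc]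

lemma unit_neg (κ : ℤ × ℤ) : unit a b (-κ) = (unit a b κ)⁻¹ :=
  eq_inv_of_mul_eq_one_left (by rw [← unit_add, neg_add_cancel, unit_zero])

lemma toOperator_unit_add (κ l : ℤ × ℤ) (v : Space) :
    toOperator (unit a b (κ + l)) v = toOperator (unit a b κ) (toOperator (unit a b l) v) := by
  rw [unit_add, toOperator_mul]

lemma toOperator_unit_vert (κ l : ℤ × ℤ) :
    toOperator (unit a b κ) (vert a b l) = vert a b (κ + l) := by
  rw [vert, vert, toOperator_unit_add]

lemma unitX_ptA : toOperator (unitX a b) (ptA a) = ptD b := by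
  rw [unitX_apply]
  apply space_ext <;> simp [ptA, ptD] <;> ring

lemma unitX_ptB : toOperator (unitX a b) ptB = ptC a b := by
  rw [unitX_apply]
  apply space_ext <;> simp [ptB, ptC]

lemma unitY_ptA : toOperator (unitY a b) (ptA a) = ptB := by
  rw [unitY_apply]
  apply space_ext <;> simp [ptA, ptB]
  ring

lemma unitY_ptD : toOperator (unitY a b) (ptD b) = ptC a b := by
  rw [unitY_apply]
  apply space_ext <;> simp [ptD, ptC] <;> ring

lemma vert_zero : vert a b 0 = ptB := by rw [vert, unit_zero, toOperator_one]

lemma vert_one_zero : vert a b (1, 0) = ptC a b := by simp [vert, unit, unitX_ptB]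

lemma vert_zero_one : vert a b (0, 1) = ptA a := by
  simp [vert, unit, toOperator_inv_apply_eq_iff, unitY_ptA]

lemma vert_one_one : vert a b (1, 1) = ptD b := by
  rw [← unitX_ptA (a := a), ← vert_zero_one (b := b)]
  simp [vert, unit, toOperator_mul]

lemma isIntegerPoint_vert (κ : ℤ × ℤ) : IsIntegerPoint (vert a b κ) := by
  refine IsIntegerPoint.map (fun i => ?_) _
  fin_cases i
  exacts [⟨0, by simp [ptB]⟩, ⟨0, by simp [ptB]⟩, ⟨1, by simp [ptB]⟩]

end Units

/-! ### The two triangles and their neighbours -/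

section Triangles

/-- The positions of the corners in the lattice of the vertices: `A`, `B`, `D` for `true` and
`C`, `D`, `B` for `false`. The half-turn of the square exchanges the two triangles. -/
def cornerIndex : Bool → Fin 3 → ℤ × ℤ
  | true => ![(0, 1), (0, 0), (1, 1)]
  | false => ![(1, 0), (1, 1), (0, 0)]

/-- The translation that moves the edge of the triangle `s` opposite to its corner `i` to an edge
of the triangle `!s`. -/
def neighbor : Bool → Fin 3 → ℤ × ℤ
  | true => ![0, (0, -1), (1, 0)]
  | false => ![0, (0, 1), (-1, 0)]

variable (a b : ℕ)

/-- The coordinates with respect to the basis of the corners of a triangle. -/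
def bar : Bool → Fin 3 → Space →ₗ[ℝ] ℝ
  | true => ![linForm 1 (-((b : ℝ) + 1)) 0,
      linForm (-((a : ℝ) + 2)) (((a : ℝ) + 2) * (b + 1) - 1 / (b + 1)) 1,
      linForm 0 (1 / ((b : ℝ) + 1)) 0]
  | false => ![linForm (-1 / ((a : ℝ) + 2)) (((b : ℝ) + 1) / (a + 2)) 0,
      linForm (1 / (((a : ℝ) + 2) * (b + 1))) (1 / ((b : ℝ) + 1) - 1 / (a + 2)) 0,
      linForm (-1 / (((a : ℝ) + 2) * (b + 1))) (1 / ((a : ℝ) + 2) - 1 / (b + 1)) 1]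

/-- The linear form that equals `1` on the plane of a triangle. -/
def triFun (s : Bool) : Space →ₗ[ℝ] ℝ := ∑ i, bar a b s i

/-- The corners of a triangle. -/
def corner (s : Bool) (i : Fin 3) : Space := vert a b (cornerIndex s i)

/-- The face of a triangle that is spanned by some of its corners. -/
def cell (s : Bool) (J : Finset (Fin 3)) : Set Space := convexHull ℝ (corner a b s '' J)

/-- The triangle `ABD` for `true` and `BCD` for `false`. -/
abbrev tri (s : Bool) : Set Space := cell a b s Finset.univ

variable {a b}

lemma corner_true : corner a b true = ![ptA a, ptB, ptD b] := by
  ext1 i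
  fin_cases i
  exacts [vert_zero_one, vert_zero, vert_one_one]

lemma corner_false : corner a b false = ![ptC a b, ptD b, ptB] := by
  ext1 i
  fin_cases i
  exacts [vert_one_zero, vert_one_one, vert_zero]

lemma tri_true : tri a b true = convexHull ℝ {ptA a, ptB, ptD b} := by
  rw [tri, cell, corner_true]
  simp [Matrix.range_cons, Set.pair_comm, Set.insert_comm]

lemma tri_false : tri a b false = convexHull ℝ {ptB, ptC a b, ptD b} := by
  rw [tri, cell, corner_false]
  simp [Matrix.range_cons, Set.pair_comm (ptC a b)]

lemma cornerIndex_injective (s : Bool) : Function.Injective (cornerIndex s) := by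
  cases s <;> decide

lemma exists_cornerIndex_add_neighbor {s : Bool} {i j : Fin 3} (hij : j ≠ i) :
    ∃ k, cornerIndex s j + neighbor s i = cornerIndex (!s) k := by
  revert s i j
  decide

lemma bar_corner (s : Bool) (i j : Fin 3) :
    bar a b s i (corner a b s j) = if i = j then 1 else 0 := by
  have ha : (a : ℝ) + 2 ≠ 0 := by positivity
  have hb : (b : ℝ) + 1 ≠ 0 := by positivity
  cases s
  · rw [corner_false]
    fin_cases i <;> fin_cases j <;> simp [bar, linForm_apply, ptB, ptC, ptD] <;> field_simp <;>
      ring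
  · rw [corner_true]
    fin_cases i <;> fin_cases j <;> simp [bar, linForm_apply, ptA, ptB, ptD] <;> field_simp <;>
      ring

lemma triFun_apply (s : Bool) (v : Space) : triFun a b s v = ∑ i, bar a b s i v := by
  simp [triFun]

lemma triFun_corner (s : Bool) (i : Fin 3) : triFun a b s (corner a b s i) = 1 := by
  simp [triFun_apply, bar_corner]

lemma triFun_true (v : Space) :
    triFun a b true v = -((a : ℝ) + 1) * v 0 + ((a : ℝ) + 1) * (b + 1) * v 1 + v 2 := by
  simp [triFun_apply, Fin.sum_univ_three, bar, linForm_apply]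
  ring

lemma triFun_false (v : Space) :
    triFun a b false v = (-v 0 + ((b : ℝ) + 1) * v 1 + (a + 2) * v 2) / (a + 2) := by
  have ha : (a : ℝ) + 2 ≠ 0 := by positivity
  simp [triFun_apply, Fin.sum_univ_three, bar, linForm_apply]
  field_simp
  ring

lemma sum_bar_smul_corner (s : Bool) (v : Space) : ∑ i, bar a b s i v • corner a b s i = v :=
  sum_smul_of_biorthogonal (bar_corner s) (by simp) v

lemma mem_cell_iff {s : Bool} {J : Finset (Fin 3)} {v : Space} : v ∈ cell a b s J ↔
    triFun a b s v = 1 ∧ (∀ i, 0 ≤ bar a b s i v) ∧ ∀ i ∉ J, bar a b s i v = 0 := by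
  refine ⟨fun hv => ?_, fun ⟨h1, h0, hJ⟩ => ?_⟩
  · let K : Set Space := (triFun a b s) ⁻¹' {1} ∩ ((⋂ i, (bar a b s i) ⁻¹' Set.Ici 0) ∩
      ⋂ i ∉ J, (bar a b s i) ⁻¹' {0})
    have hK : Convex ℝ K := ((convex_singleton 1).linear_preimage _).inter
      ((convex_iInter fun i => (convex_Ici 0).linear_preimage _).inter
        (convex_iInter₂ fun i _ => (convex_singleton 0).linear_preimage _))
    have hc : corner a b s '' J ⊆ K := by
      rintro - ⟨j, hj, rfl⟩
      refine ⟨triFun_corner s j, Set.mem_iInter.2 fun i => ?_, Set.mem_iInter₂.2 fun i hi => ?_⟩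
      · simp only [Set.mem_preimage, bar_corner, Set.mem_Ici]
        split_ifs <;> norm_num
      · exact (bar_corner s i j).trans (if_neg (ne_of_mem_of_not_mem hj hi).symm)
    have hvK := convexHull_min hc hK hv
    exact ⟨hvK.1, Set.mem_iInter.1 hvK.2.1, fun i hi => Set.mem_iInter₂.1 hvK.2.2 i hi⟩
  · rw [triFun_apply, ← Finset.sum_subset J.subset_univ fun i _ => hJ i] at h1
    rw [← sum_bar_smul_corner s v, ← Finset.sum_subset J.subset_univ fun i _ hi => by
      rw [hJ i hi, zero_smul]]
    exact (convex_convexHull ℝ _).sum_mem (fun i _ => h0 i) h1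
      fun i hi => subset_convexHull ℝ _ (Set.mem_image_of_mem _ hi)

lemma mem_tri_iff {s : Bool} {v : Space} :
    v ∈ tri a b s ↔ triFun a b s v = 1 ∧ ∀ i, 0 ≤ bar a b s i v := by
  simp [mem_cell_iff]

/-- The two triangles on each edge bend towards the origin: this is the local convexity of the
sail. -/
lemma one_lt_triFun_neighbor (s : Bool) (i : Fin 3) :
    1 < triFun a b (!s) (vert a b (cornerIndex s i + neighbor s i)) := by
  have ha : (0 : ℝ) ≤ a := a.cast_nonneg
  have hb : (0 : ℝ) ≤ b := b.cast_nonneg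
  have hab : (0 : ℝ) < (b + 1) * ((a + 2) * (b + 1) - 1) :=
    mul_pos (by positivity) (by nlinarith [mul_nonneg ha hb])
  rw [add_comm, ← toOperator_unit_vert]
  change 1 < triFun a b (!s) (toOperator _ (corner a b s i))
  cases s <;> fin_cases i <;>
    simp [corner_true, corner_false, neighbor, unit, toOperator_one, unitX_apply,
      unitX_inv_apply, unitY_apply, unitY_inv_apply, triFun_true, triFun_false, ptA, ptB, ptC,
      ptD]
  all_goals try rw [lt_div_iff₀ (by positivity)]
  all_goals nlinarith

/-- Both sides are linear in `v` and agree on the corners of the triangle `s`. -/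
lemma triFun_neighbor_sub (s : Bool) (i : Fin 3) (v : Space) :
    triFun a b (!s) (toOperator (unit a b (neighbor s i)) v) - triFun a b s v =
      (triFun a b (!s) (vert a b (cornerIndex s i + neighbor s i)) - 1) * bar a b s i v := by
  have hcorner (j : Fin 3) (hj : j ≠ i) :
      triFun a b (!s) (vert a b (cornerIndex s j + neighbor s i)) = 1 := by
    obtain ⟨k, hk⟩ := exists_cornerIndex_add_neighbor hj
    rw [hk, ← corner, triFun_corner]
  have hv : toOperator (unit a b (neighbor s i)) v =
      ∑ j, bar a b s j v • vert a b (cornerIndex s j + neighbor s i) := by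
    conv_lhs => rw [← sum_bar_smul_corner (a := a) (b := b) s v]
    simp only [map_sum, map_smul, corner, toOperator_unit_vert, add_comm]
  rw [hv, triFun_apply s v, map_sum, ← Finset.sum_sub_distrib, Finset.sum_eq_single i]
  · rw [map_smul, smul_eq_mul]; ring
  · intro j _ hj
    rw [map_smul, hcorner j hj, smul_eq_mul, mul_one, sub_self]
  · simp

end Triangles

/-! ### Eigenvectors -/

/-- The three roots of `t (t + a + 2) (t - (b + 1)) = 1`, the eigenvalues of `M⁻¹`, with their
localization. -/
structure Roots (a b : ℕ) where
  t : Fin 3 → ℝ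
  eq : ∀ i, t i * (t i + (a + 2)) * (t i - (b + 1)) = 1
  lt₀ : (b : ℝ) + 1 < t 0
  lt₁ : -1 < t 1 * (a + 2)
  neg₁ : t 1 < 0
  add_pos₂ : 0 < t 2 + (a + 2)
  lt₂ : (t 2 + (a + 2)) * (a + 2) < 1

lemma Roots.exists (a b : ℕ) : Nonempty (Roots a b) := by
  have ha : (0 : ℝ) ≤ a := a.cast_nonneg
  have hb : (0 : ℝ) ≤ b := b.cast_nonneg
  set f : ℝ → ℝ := fun t => t * (t + (a + 2)) * (t - (b + 1)) with hf
  have hc : Continuous f := by fun_prop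
  obtain ⟨u, hu⟩ : ∃ u : ℝ, u * (a + 2) = 1 := ⟨1 / (a + 2), by field_simp⟩
  have hu0 : 0 < u := pos_of_mul_pos_left (hu ▸ one_pos) (by positivity)
  have hu2 : u ≤ 1 / 2 := by nlinarith
  have hf₀ : (1 : ℝ) ∈ Set.Ioo (f (b + 1)) (f (b + 2)) := by
    constructor <;> simp only [hf] <;> nlinarith [mul_nonneg ha hb]
  have hf₁ : (1 : ℝ) ∈ Set.Ioo (f 0) (f (-u)) := by
    have : f (-u) = (1 - u ^ 2) * (u + 1 + b) := by
      linear_combination (u + 1 + b) * hu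
    rw [this]
    constructor
    · simp [hf]
    · nlinarith [mul_nonneg hb (by nlinarith : 0 ≤ 1 - u ^ 2), mul_pos hu0 hu0]
  have hf₂ : (1 : ℝ) ∈ Set.Ioo (f (-(a + 2))) (f (-(a + 2) + u)) := by
    have : f (-(a + 2) + u) = (1 - u ^ 2) * (a + 3 + b - u) := by
      linear_combination (a + 3 + b - u) * hu
    rw [this]
    constructor
    · simp [hf]
    · nlinarith [mul_nonneg (by nlinarith : 0 ≤ 1 - u ^ 2 - 3 / 4)
        (by linarith : 0 ≤ a + 3 + b - u)]
  obtain ⟨t₀, ⟨h₀, -⟩, e₀⟩ := intermediate_value_Ioo (by linarith) hc.continuousOn hf₀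
  obtain ⟨t₁, ⟨h₁, h₁'⟩, e₁⟩ := intermediate_value_Ioo' (by linarith) hc.continuousOn hf₁
  obtain ⟨t₂, ⟨h₂, h₂'⟩, e₂⟩ := intermediate_value_Ioo (by linarith) hc.continuousOn hf₂
  exact ⟨{ t := ![t₀, t₁, t₂]
           eq := fun i => by fin_cases i; exacts [e₀, e₁, e₂]
           lt₀ := h₀
           lt₁ := show -1 < t₁ * (a + 2) by nlinarith
           neg₁ := h₁'
           add_pos₂ := show 0 < t₂ + (a + 2) by linarith
           lt₂ := show (t₂ + (a + 2)) * (a + 2) < 1 by nlinarith }⟩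

namespace Roots

variable {a b : ℕ} (r : Roots a b)

lemma neg_one_lt₁ : -1 < r.t 1 := by
  have ha : (0 : ℝ) ≤ a := a.cast_nonneg
  nlinarith [r.lt₁, r.neg₁]

lemma lt_neg_one₂ : r.t 2 < -1 := by
  have ha : (0 : ℝ) ≤ a := a.cast_nonneg
  nlinarith [r.lt₂, r.add_pos₂]

lemma pos₀ : 0 < r.t 0 := by
  have hb : (0 : ℝ) ≤ b := b.cast_nonneg
  linarith [r.lt₀]

lemma neg₂ : r.t 2 < 0 := by linarith [r.lt_neg_one₂]

lemma one_lt_add₀ : 1 < r.t 0 + (a + 2) := by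
  have ha : (0 : ℝ) ≤ a := a.cast_nonneg
  linarith [r.pos₀]

lemma one_lt_add₁ : 1 < r.t 1 + (a + 2) := by
  have ha : (0 : ℝ) ≤ a := a.cast_nonneg
  linarith [r.neg_one_lt₁]

lemma add_pos (i : Fin 3) : 0 < r.t i + (a + 2) := by
  fin_cases i
  exacts [one_pos.trans r.one_lt_add₀, one_pos.trans r.one_lt_add₁, r.add_pos₂]

lemma t_ne_zero (i : Fin 3) : r.t i ≠ 0 := fun h => by simpa [h] using r.eq i

lemma sq_pos (i : Fin 3) : 0 < r.t i ^ 2 := pow_two_pos_of_ne_zero (r.t_ne_zero i)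

lemma t_injective : Function.Injective r.t := by
  have h₀₁ : r.t 1 < r.t 0 := r.neg₁.trans r.pos₀
  have h₁₂ : r.t 2 < r.t 1 := r.lt_neg_one₂.trans r.neg_one_lt₁
  have h : StrictAnti r.t := Fin.strictAnti_iff_succ_lt.2 fun i => by
    fin_cases i
    exacts [h₀₁, h₁₂]
  exact h.injective

/-- The left eigenvectors of `M⁻¹`, normalized by the value `1` at the point `B`. They identify
the space with the product of the real completions of the cubic field. -/
def coord (i : Fin 3) : Space →ₗ[ℝ] ℝ :=
  linForm (r.t i) (r.t i ^ 2 - ((b : ℝ) - a - 1) * r.t i) 1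

/-- The right eigenvectors of `M⁻¹`. -/
def eigen (i : Fin 3) : Space :=
  !₂[r.t i, 1, r.t i ^ 2 - ((b : ℝ) - a - 1) * r.t i - (a + 2) * (b + 1)]

/-- The product of the differences of a root with the two others. -/
def der (i : Fin 3) : ℝ := r.coord i (r.eigen i)

/-- The right eigenvectors normalized to be dual to `coord`. -/
def dual (i : Fin 3) : Space := (r.der i)⁻¹ • r.eigen i

lemma coord_apply (i : Fin 3) (v : Space) : r.coord i v =
    r.t i * v 0 + (r.t i ^ 2 - ((b : ℝ) - a - 1) * r.t i) * v 1 + v 2 := by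
  rw [coord, linForm_apply, one_mul]

lemma coord_eigen (i j : Fin 3) : r.coord i (r.eigen j) = r.t i * r.t j + r.t i ^ 2 + r.t j ^ 2 -
    ((b : ℝ) - a - 1) * (r.t i + r.t j) - (a + 2) * (b + 1) := by
  simp [coord_apply, eigen]
  ring

lemma coord_eigen_of_ne {i j : Fin 3} (hij : i ≠ j) : r.coord i (r.eigen j) = 0 := by
  apply mul_left_cancel₀ (sub_ne_zero.2 (r.t_injective.ne hij))
  rw [coord_eigen]
  linear_combination r.eq i - r.eq j

lemma der_eq {i j k : Fin 3} (hij : i ≠ j) (hik : i ≠ k) (hjk : j ≠ k) :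
    r.der i = (r.t i - r.t j) * (r.t i - r.t k) := by
  have eij := r.coord_eigen_of_ne hij
  have eik := r.coord_eigen_of_ne hik
  rw [coord_eigen] at eij eik
  have hsum : r.t i + r.t j + r.t k - (b - a - 1) = 0 := by
    apply mul_left_cancel₀ (sub_ne_zero.2 (r.t_injective.ne hjk))
    linear_combination eij - eik
  rw [der, coord_eigen]
  linear_combination eij + (r.t i - r.t j) * hsum

lemma der_pos₀ : 0 < r.der 0 := by
  rw [r.der_eq (i := 0) (j := 1) (k := 2) (by decide) (by decide) (by decide)]
  exact mul_pos (by linarith [r.pos₀, r.neg₁]) (by linarith [r.pos₀, r.neg₂])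

lemma der_neg₁ : r.der 1 < 0 := by
  rw [r.der_eq (i := 1) (j := 0) (k := 2) (by decide) (by decide) (by decide)]
  exact mul_neg_of_neg_of_pos (by linarith [r.pos₀, r.neg₁])
    (by linarith [r.neg_one_lt₁, r.lt_neg_one₂])

lemma der_pos₂ : 0 < r.der 2 := by
  rw [r.der_eq (i := 2) (j := 0) (k := 1) (by decide) (by decide) (by decide)]
  exact mul_pos_of_neg_of_neg (by linarith [r.pos₀, r.neg₂])
    (by linarith [r.neg_one_lt₁, r.lt_neg_one₂])

lemma der_ne_zero (i : Fin 3) : r.der i ≠ 0 := by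
  fin_cases i
  exacts [r.der_pos₀.ne', r.der_neg₁.ne, r.der_pos₂.ne']

lemma coord_dual (i j : Fin 3) : r.coord i (r.dual j) = if i = j then 1 else 0 := by
  rw [dual, map_smul, smul_eq_mul]
  split_ifs with h
  · rw [h, ← der, inv_mul_cancel₀ (r.der_ne_zero j)]
  · rw [r.coord_eigen_of_ne h, mul_zero]

lemma sum_coord_smul_dual (v : Space) : ∑ i, r.coord i v • r.dual i = v :=
  sum_smul_of_biorthogonal r.coord_dual (by simp) v

/-- The coordinates with respect to the eigenvectors. -/
def coordEquiv : Space ≃L[ℝ] (Fin 3 → ℝ) :=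
  LinearEquiv.toContinuousLinearEquiv
    { LinearMap.pi r.coord with
      invFun := fun c => ∑ i, c i • r.dual i
      left_inv := r.sum_coord_smul_dual
      right_inv := fun c => by
        ext i
        simp [coord_dual] }

lemma coordEquiv_apply (v : Space) (i : Fin 3) : r.coordEquiv v i = r.coord i v := rfl

lemma eq_of_coord {v w : Space} (h : ∀ i, r.coord i v = r.coord i w) : v = w :=
  r.coordEquiv.injective (funext h)

lemma continuous_coord (i : Fin 3) : Continuous (r.coord i) :=
  (r.coord i).continuous_of_finiteDimensional

lemma coord_ptB (i : Fin 3) : r.coord i ptB = 1 := by simp [coord_apply, ptB]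

lemma coord_frob_inv (i : Fin 3) (v : Space) :
    r.coord i (toOperator (frob a b)⁻¹ v) = r.t i * r.coord i v := by
  simp [coord_apply, frob_inv_apply]
  linear_combination - v 1 * r.eq i

lemma coord_frob (i : Fin 3) (v : Space) :
    r.coord i (toOperator (frob a b) v) = (r.t i)⁻¹ * r.coord i v := by
  rw [eq_inv_mul_iff_mul_eq₀ (r.t_ne_zero i), ← coord_frob_inv, toOperator_inv_apply_self]

lemma frob_dual (i : Fin 3) : toOperator (frob a b) (r.dual i) = (r.t i)⁻¹ • r.dual i := by
  refine r.eq_of_coord fun j => ?_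
  rw [coord_frob, map_smul, coord_dual, smul_eq_mul]
  split_ifs with h
  · rw [h]
  · simp

lemma coord_of_commute {g : SL(3, ℤ)} (hg : Commute g (frob a b)) (i : Fin 3) (v : Space) :
    r.coord i (toOperator g v) = r.coord i (toOperator g ptB) * r.coord i v := by
  have hdual {j : Fin 3} (hj : j ≠ i) : r.coord i (toOperator g (r.dual j)) = 0 := by
    have h := congr_arg (r.coord i) (congr_arg (fun g => toOperator g (r.dual j)) hg.eq)
    simp only [toOperator_mul, frob_dual, coord_frob, map_smul, smul_eq_mul] at h
    have ht : (r.t j)⁻¹ - (r.t i)⁻¹ ≠ 0 :=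
      sub_ne_zero.2 (inv_injective.ne (r.t_injective.ne hj))
    exact (mul_eq_zero.1 (by linear_combination h :
      ((r.t j)⁻¹ - (r.t i)⁻¹) * r.coord i (toOperator g (r.dual j)) = 0)).resolve_left ht
  have hv (v : Space) : r.coord i (toOperator g v) =
      r.coord i v * r.coord i (toOperator g (r.dual i)) := by
    conv_lhs => rw [← r.sum_coord_smul_dual v]
    simp only [map_sum, map_smul, smul_eq_mul]
    exact Finset.sum_eq_single i (fun j _ hj => by rw [hdual hj, mul_zero]) (by simp)
  rw [hv v, hv ptB, coord_ptB, one_mul, mul_comm]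

/-! ### The units in the eigencoordinates -/

/-- The eigenvalues of the operator `unit κ`. -/
def eps (i : Fin 3) (κ : ℤ × ℤ) : ℝ := (r.t i ^ 2) ^ κ.1 * (r.t i + (a + 2)) ^ κ.2

lemma eps_pos (i : Fin 3) (κ : ℤ × ℤ) : 0 < r.eps i κ :=
  mul_pos (zpow_pos (r.sq_pos i) _) (zpow_pos (r.add_pos i) _)

lemma coord_zpow {i : Fin 3} {g : SL(3, ℤ)} {c : ℝ} (hc : c ≠ 0)
    (h : ∀ v, r.coord i (toOperator g v) = c * r.coord i v) (n : ℤ) (v : Space) :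
    r.coord i (toOperator (g ^ n) v) = c ^ n * r.coord i v := by
  have hinv (v : Space) : r.coord i (toOperator g⁻¹ v) = c⁻¹ * r.coord i v := by
    rw [eq_inv_mul_iff_mul_eq₀ hc, ← h, toOperator_apply_inv_self]
  induction n generalizing v with
  | zero => simp [toOperator_one]
  | succ n ih => rw [zpow_add_one, toOperator_mul, ih, h, zpow_add_one₀ hc, mul_assoc]
  | pred n ih => rw [zpow_sub_one, toOperator_mul, ih, hinv, zpow_sub_one₀ hc, mul_assoc]

lemma coord_unit (i : Fin 3) (κ : ℤ × ℤ) (v : Space) :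
    r.coord i (toOperator (unit a b κ) v) = r.eps i κ * r.coord i v := by
  have hX (v : Space) : r.coord i (toOperator (unitX a b) v) = r.t i ^ 2 * r.coord i v := by
    rw [unitX, pow_two, toOperator_mul, coord_frob_inv, coord_frob_inv, pow_two, mul_assoc]
  have hY (v : Space) :
      r.coord i (toOperator (unitY a b)⁻¹ v) = (r.t i + (a + 2)) * r.coord i v := by
    simp [coord_apply, unitY_inv_apply]
    linear_combination - v 1 * r.eq i
  rw [unit, toOperator_mul, r.coord_zpow (r.sq_pos i).ne' hX, r.coord_zpow (r.add_pos i).ne' hY,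
    eps, mul_assoc]

lemma coord_vert (i : Fin 3) (κ : ℤ × ℤ) : r.coord i (vert a b κ) = r.eps i κ := by
  rw [vert, coord_unit, coord_ptB, mul_one]

lemma log_eps (i : Fin 3) (κ : ℤ × ℤ) : Real.log (r.eps i κ) =
    κ.1 * Real.log (r.t i ^ 2) + κ.2 * Real.log (r.t i + (a + 2)) := by
  rw [eps, Real.log_mul (zpow_pos (r.sq_pos i) _).ne' (zpow_pos (r.add_pos i) _).ne',
    Real.log_zpow, Real.log_zpow]

lemma one_lt_sq₀ : 1 < r.t 0 ^ 2 := by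
  have hb : (0 : ℝ) ≤ b := b.cast_nonneg
  nlinarith [r.lt₀]

lemma sq_lt_one₁ : r.t 1 ^ 2 < 1 := by nlinarith [r.neg_one_lt₁, r.neg₁]

lemma one_lt_sq₂ : 1 < r.t 2 ^ 2 := by nlinarith [r.lt_neg_one₂]

/-- The volume of the lattice of the logarithms of the units. -/
def regulator : ℝ := Real.log (r.t 0 ^ 2) * Real.log (r.t 1 + (a + 2)) -
  Real.log (r.t 1 ^ 2) * Real.log (r.t 0 + (a + 2))

lemma regulator_pos : 0 < r.regulator := by
  have h₁ := mul_pos (Real.log_pos r.one_lt_sq₀) (Real.log_pos r.one_lt_add₁)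
  have h₂ := mul_neg_of_neg_of_pos (Real.log_neg (r.sq_pos 1) r.sq_lt_one₁)
    (Real.log_pos r.one_lt_add₀)
  rw [regulator]
  linarith

lemma eps_lt_one_of_neg {i : Fin 3} (hi : r.t i < 0) : r.eps i (1, 1) < 1 := by
  have hb : (0 : ℝ) ≤ b := b.cast_nonneg
  have h : r.eps i (1, 1) = r.t i / (r.t i - (b + 1)) := by
    rw [eq_div_iff (by linarith)]
    simp [eps]
    linear_combination r.t i * r.eq i
  rw [h, div_lt_one_of_neg (by linarith)]
  linarith

lemma exists_eps_lt_one (i : Fin 3) : ∃ κ, ∀ j ≠ i, r.eps j κ < 1 := by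
  match i with
  | 0 => exact ⟨(1, 1), Fin.forall_fin_succ.2 ⟨by simp, Fin.forall_fin_two.2
      ⟨fun _ => r.eps_lt_one_of_neg r.neg₁, fun _ => r.eps_lt_one_of_neg r.neg₂⟩⟩⟩
  | 1 => exact ⟨(-1, 0), fun j hj => by
      fin_cases j
      · simpa [eps] using inv_lt_one_of_one_lt₀ r.one_lt_sq₀
      · simp at hj
      · simpa [eps] using inv_lt_one_of_one_lt₀ r.one_lt_sq₂⟩
  | 2 => exact ⟨(0, -1), fun j hj => by
      fin_cases j
      · simpa [eps] using inv_lt_one_of_one_lt₀ r.one_lt_add₀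
      · simpa [eps] using inv_lt_one_of_one_lt₀ r.one_lt_add₁
      · simp at hj⟩

end Roots

lemma eq_one_of_commute {a b : ℕ} {g : SL(3, ℤ)} (hg : Commute g (frob a b))
    (hB : toOperator g ptB = ptB) : g = 1 := by
  obtain ⟨r⟩ := Roots.exists a b
  refine toOperator_injective (LinearMap.ext fun v => r.eq_of_coord fun i => ?_)
  rw [r.coord_of_commute hg, hB, r.coord_ptB, one_mul, toOperator_one]

/-! ### Irreducibility -/

section Irreducible

open Polynomial

variable {a b : ℕ}

lemma charpoly_frob : ((frob a b : Matrix (Fin 3) (Fin 3) ℤ).map (Int.cast : ℤ → ℚ)).charpoly =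
    X ^ 3 + C (((a : ℚ) + 2) * (b + 1)) * X ^ 2 + C ((b : ℚ) - a - 1) * X - 1 := by
  rw [Matrix.charpoly, Matrix.det_fin_three]
  simp [frob, frobeniusOperator]
  ring

lemma natDegree_charpoly_frob :
    ((frob a b : Matrix (Fin 3) (Fin 3) ℤ).map (Int.cast : ℤ → ℚ)).charpoly.natDegree = 3 := by
  rw [Matrix.charpoly_natDegree_eq_dim, Fintype.card_fin]

/-- A rational root would be an integer dividing `1`, and neither `1` nor `-1` is a root. -/
lemma irreducible_charpoly_frob :
    Irreducible ((frob a b : Matrix (Fin 3) (Fin 3) ℤ).map (Int.cast : ℤ → ℚ)).charpoly := by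
  have hmonic := Matrix.charpoly_monic
    ((frob a b : Matrix (Fin 3) (Fin 3) ℤ).map (Int.cast : ℤ → ℚ))
  rw [hmonic.irreducible_iff_roots_eq_zero_of_degree_le_three
    (by rw [natDegree_charpoly_frob]; norm_num) natDegree_charpoly_frob.le,
    Multiset.eq_zero_iff_forall_notMem]
  intro x hx
  rw [mem_roots hmonic.ne_zero, IsRoot, charpoly_frob] at hx
  have hint : IsIntegral ℤ x :=
    ⟨X ^ 3 + C (((a : ℤ) + 2) * (b + 1)) * X ^ 2 + C ((b : ℤ) - a - 1) * X - 1,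
      by monicity!, by simpa using hx⟩
  obtain ⟨k, rfl⟩ := IsIntegrallyClosed.isIntegral_iff.1 hint
  have hk : k * (k ^ 2 + (a + 2) * (b + 1) * k + (b - a - 1)) = 1 := by
    simp only [algebraMap_int_eq, eq_intCast, map_mul, map_add, map_natCast, map_one, map_sub,
      eval_sub, eval_add, eval_pow, eval_X, eval_mul, eval_natCast, eval_C, eval_one] at hx
    exact_mod_cast (by linear_combination hx :
      (k : ℚ) * (k ^ 2 + (a + 2) * (b + 1) * k + (b - a - 1)) = 1)
  have hab : 0 ≤ (a : ℤ) * b := by positivity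
  rcases Int.eq_one_or_neg_one_of_mul_eq_one hk with rfl | rfl <;> nlinarith

namespace Roots

variable (r : Roots a b)

lemma minpoly_inv (i : Fin 3) : minpoly ℚ (r.t i)⁻¹ =
    ((frob a b : Matrix (Fin 3) (Fin 3) ℤ).map (Int.cast : ℤ → ℚ)).charpoly := by
  refine (minpoly.eq_of_irreducible_of_monic irreducible_charpoly_frob ?_
    (Matrix.charpoly_monic _)).symm
  have ht := r.t_ne_zero i
  simp [charpoly_frob]
  field_simp
  linear_combination - r.eq i

lemma coord_ne_zero {v : Space} (hv : IsIntegerPoint v) (h0 : v ≠ 0) (i : Fin 3) :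
    r.coord i v ≠ 0 := by
  intro h
  choose k hk using hv
  have ht := r.t_ne_zero i
  have hdeg : (minpoly ℚ (r.t i)⁻¹).natDegree = 3 := by
    rw [minpoly_inv, natDegree_charpoly_frob]
  have hli := (linearIndependent_pow (K := ℚ) (r.t i)⁻¹).comp _ (Fin.cast_injective hdeg.symm)
  have hc := Fintype.linearIndependent_iff.1 hli
    ![(k 1 : ℚ), k 0 - ((b : ℚ) - a - 1) * k 1, k 2] (by
      rw [coord_apply, hk, hk, hk] at h
      simp [Fin.sum_univ_three, Rat.smul_def]
      field_simp
      linear_combination h)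
  simp only [Fin.forall_fin_succ, Matrix.cons_val_zero, Matrix.cons_val_succ,
    IsEmpty.forall_iff, and_true] at hc
  obtain ⟨h1, h0', h2⟩ := hc
  rw [h1, mul_zero, sub_zero] at h0'
  norm_cast at h1 h0' h2
  exact h0 (space_ext (by simp [hk, h0']) (by simp [hk, h1]) (by simp [hk, h2]))

end Roots

end Irreducible

/-! ### Orthants -/

namespace Roots

variable {a b : ℕ} (r : Roots a b)

lemma hasEigenvector_dual (i : Fin 3) :
    Module.End.HasEigenvector (toOperator (frob a b)) (r.t i)⁻¹ (r.dual i) :=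
  ⟨Module.End.mem_eigenspace_iff.2 (r.frob_dual i),
    fun h => by simpa [h] using r.coord_dual i i⟩

lemma exists_coord_eq_zero {u : Space} (hu : IsEigenvector (frob a b) u) :
    ∃ i, ∀ j ≠ i, r.coord j u = 0 := by
  obtain ⟨μ, hu⟩ := hu
  have hμ {j : Fin 3} (hj : r.coord j u ≠ 0) : (r.t j)⁻¹ = μ := by
    have h := congr_arg (r.coord j) hu.apply_eq_smul
    rw [r.coord_frob, map_smul, smul_eq_mul] at h
    exact mul_right_cancel₀ hj h
  by_cases h : ∃ i, r.coord i u ≠ 0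
  · obtain ⟨i, hi⟩ := h
    refine ⟨i, fun j hj => by_contra fun hj' => hj ?_⟩
    exact r.t_injective (inv_injective ((hμ hj').trans (hμ hi).symm))
  · push Not at h
    exact ⟨0, fun j _ => h j⟩

lemma linearIndependent_dual {i j : Fin 3} (hij : i ≠ j) :
    LinearIndependent ℝ ![r.dual i, r.dual j] := by
  refine LinearIndependent.pair_iff.2 fun s t h => ?_
  have hi := congr_arg (r.coord i) h
  have hj := congr_arg (r.coord j) h
  simpa [coord_dual, hij, hij.symm] using And.intro hi hj

lemma planesComplement_eq : planesComplement (frob a b) = {v | ∀ i, r.coord i v ≠ 0} := by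
  ext v
  constructor
  · intro hv i hi
    obtain ⟨j, k, hij, hjk, hik, hs⟩ : ∃ j k : Fin 3, j ≠ i ∧ j ≠ k ∧ k ≠ i ∧
        (Finset.univ : Finset (Fin 3)) = {i, j, k} := by
      clear hi; revert i; decide
    refine hv _ ⟨r.dual j, r.dual k, ⟨_, r.hasEigenvector_dual j⟩, ⟨_, r.hasEigenvector_dual k⟩,
      r.linearIndependent_dual hjk, rfl⟩ ?_
    refine Submodule.mem_span_pair.2 ⟨r.coord j v, r.coord k v, ?_⟩
    conv_rhs => rw [← r.sum_coord_smul_dual v, hs, Finset.sum_insert (by simp [hij.symm, hik.symm]),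
      Finset.sum_pair hjk, hi, zero_smul, zero_add]
  · rintro hv _ ⟨u, w, hu, hw, -, rfl⟩ h
    obtain ⟨i, hi⟩ := r.exists_coord_eq_zero hu
    obtain ⟨j, hj⟩ := r.exists_coord_eq_zero hw
    obtain ⟨k, hki, hkj⟩ : ∃ k : Fin 3, k ≠ i ∧ k ≠ j := by
      clear hi hj; revert i j; decide
    obtain ⟨p, q, rfl⟩ := Submodule.mem_span_pair.1 h
    exact hv k (by simp [hi k hki, hj k hkj])

lemma coord_mul_pos {x y : Space} (hy : y ∈ connectedComponentIn (planesComplement (frob a b)) x)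
    (i : Fin 3) : 0 < r.coord i x * r.coord i y := by
  have hx := mem_connectedComponentIn (connectedComponentIn_nonempty_iff.1 ⟨y, hy⟩)
  have hne : ∀ z ∈ connectedComponentIn (planesComplement (frob a b)) x, r.coord i z ≠ 0 := by
    intro z hz
    have hz' := connectedComponentIn_subset _ _ hz
    rw [r.planesComplement_eq] at hz'
    exact hz' i
  have hc := (r.continuous_coord i).continuousOn
    (s := connectedComponentIn (planesComplement (frob a b)) x)
  by_contra hneg
  obtain ⟨z, hz, h0⟩ : (0 : ℝ) ∈
      r.coord i '' connectedComponentIn (planesComplement (frob a b)) x := by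
    rcases mul_nonpos_iff.1 (not_lt.1 hneg) with ⟨h1, h2⟩ | ⟨h1, h2⟩
    · exact isPreconnected_connectedComponentIn.intermediate_value hy hx hc ⟨h2, h1⟩
    · exact isPreconnected_connectedComponentIn.intermediate_value hx hy hc ⟨h1, h2⟩
  exact hne z hz h0

/-- The open orthant that contains `B`. -/
def orth : Set Space := {v | ∀ i, 0 < r.coord i v}

lemma orth_eq_preimage : r.orth = r.coordEquiv ⁻¹' Set.univ.pi fun _ => Set.Ioi 0 := by
  ext v
  simp [orth, coordEquiv_apply]

lemma convex_orth : Convex ℝ r.orth := by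
  rw [orth_eq_preimage]
  exact (convex_pi fun _ _ => convex_Ioi 0).linear_preimage r.coordEquiv.toLinearMap

lemma isOpen_orth : IsOpen r.orth := by
  rw [orth_eq_preimage]
  exact (isOpen_set_pi Set.finite_univ fun _ _ => isOpen_Ioi).preimage r.coordEquiv.continuous

lemma mem_closure_orth {v : Space} : v ∈ closure r.orth ↔ ∀ i, 0 ≤ r.coord i v := by
  rw [orth_eq_preimage, ← r.coordEquiv.coe_toHomeomorph, ← Homeomorph.preimage_closure,
    closure_pi_set]
  simp [Pi.le_def, coordEquiv_apply]

lemma ptB_mem_orth : ptB ∈ r.orth := fun i => by rw [coord_ptB]; exact one_pos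

lemma orth_subset : r.orth ⊆ planesComplement (frob a b) := by
  rw [r.planesComplement_eq]
  exact fun v hv i => (hv i).ne'

lemma connectedComponentIn_eq_orth {x : Space} (hx : x ∈ r.orth) :
    connectedComponentIn (planesComplement (frob a b)) x = r.orth := by
  apply Set.Subset.antisymm
  · exact fun y hy i => pos_of_mul_pos_right (r.coord_mul_pos hy i) (hx i).le
  · exact r.convex_orth.isPreconnected.subset_connectedComponentIn hx r.orth_subset

lemma isOrthant_orth : IsOrthant (frob a b) r.orth :=
  ⟨ptB, r.orth_subset r.ptB_mem_orth, (r.connectedComponentIn_eq_orth r.ptB_mem_orth).symm⟩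

lemma eq_orth {O : Set Space} (hO : IsOrthant (frob a b) O) (hB : ptB ∈ integerHull O) :
    O = r.orth := by
  obtain ⟨x, hx, rfl⟩ := hO
  refine r.connectedComponentIn_eq_orth fun i => ?_
  have hclosed : IsClosed {v | 0 ≤ r.coord i x * r.coord i v} :=
    isClosed_le continuous_const (continuous_const.mul (r.continuous_coord i))
  have hconv : Convex ℝ {v | 0 ≤ r.coord i x * r.coord i v} :=
    convex_halfSpace_ge (r.coord i x • r.coord i).isLinear 0
  have h : 0 ≤ r.coord i x * r.coord i ptB := convexHull_min (fun v hv => closure_minimal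
    (fun y hy => (r.coord_mul_pos hy i).le) hclosed hv.1) hconv hB
  rw [r.coord_ptB, mul_one] at h
  rw [r.planesComplement_eq] at hx
  exact h.lt_of_ne' (hx i)

lemma mem_orth_of_integer {v : Space} (hv : IsIntegerPoint v) (h0 : v ≠ 0)
    (h : v ∈ closure r.orth) : v ∈ r.orth :=
  fun i => (r.mem_closure_orth.1 h i).lt_of_ne' (r.coord_ne_zero hv h0 i)

lemma unit_mem_orth_iff {κ : ℤ × ℤ} {v : Space} :
    toOperator (unit a b κ) v ∈ r.orth ↔ v ∈ r.orth := by
  simp only [orth, Set.mem_ofPred_eq, coord_unit, mul_pos_iff_of_pos_left (r.eps_pos _ κ)]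

lemma vert_mem_orth (κ : ℤ × ℤ) : vert a b κ ∈ r.orth := r.unit_mem_orth_iff.2 r.ptB_mem_orth

end Roots

lemma exists_eigenvalues (a b : ℕ) : ∃ s : Fin 3 → ℝ, Function.Injective s ∧
    ∀ i, Module.End.HasEigenvalue (toOperator (frob a b)) (s i) := by
  obtain ⟨r⟩ := Roots.exists a b
  exact ⟨fun i => (r.t i)⁻¹, inv_injective.comp r.t_injective,
    fun i => Module.End.hasEigenvalue_of_hasEigenvector (r.hasEigenvector_dual i)⟩

/-! ### The hull and the sail -/

namespace Roots

variable {a b : ℕ} (r : Roots a b)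

lemma triFun_true_dual (i : Fin 3) :
    triFun a b true (r.dual i) = (r.t i + 1) * ((r.t i - (b + 1)) / r.der i) := by
  simp [dual, triFun_true, eigen]
  ring

lemma triFun_false_dual (i : Fin 3) : triFun a b false (r.dual i) =
    ((r.t i + (a + 2)) * (a + 2) - 1) / (a + 2) * ((r.t i - (b + 1)) / r.der i) := by
  have ha : (a : ℝ) + 2 ≠ 0 := by positivity
  have hr := r.der_ne_zero i
  simp [dual, triFun_false, eigen]
  field_simp
  ring

lemma triFun_dual_pos (s : Bool) (i : Fin 3) : 0 < triFun a b s (r.dual i) := by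
  have ha : (0 : ℝ) ≤ a := a.cast_nonneg
  have hb : (0 : ℝ) ≤ b := b.cast_nonneg
  have h₀ : 0 < (r.t 0 - (b + 1)) / r.der 0 := div_pos (sub_pos.2 r.lt₀) r.der_pos₀
  have h₁ : 0 < (r.t 1 - (b + 1)) / r.der 1 :=
    div_pos_of_neg_of_neg (by linarith [r.neg₁]) r.der_neg₁
  have h₂ : (r.t 2 - (b + 1)) / r.der 2 < 0 :=
    div_neg_of_neg_of_pos (by linarith [r.neg₂]) r.der_pos₂
  cases s
  · rw [r.triFun_false_dual]
    match i with
    | 0 => exact mul_pos (div_pos (by nlinarith [r.one_lt_add₀]) (by positivity)) h₀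
    | 1 => exact mul_pos (div_pos (by nlinarith [r.one_lt_add₁]) (by positivity)) h₁
    | 2 =>
      exact mul_pos_of_neg_of_neg (div_neg_of_neg_of_pos (sub_neg.2 r.lt₂) (by positivity)) h₂
  · rw [r.triFun_true_dual]
    match i with
    | 0 => exact mul_pos (by linarith [r.pos₀]) h₀
    | 1 => exact mul_pos (by linarith [r.neg_one_lt₁]) h₁
    | 2 => exact mul_pos_of_neg_of_neg (by linarith [r.lt_neg_one₂]) h₂

lemma triFun_unit (s : Bool) (κ : ℤ × ℤ) (v : Space) : triFun a b s (toOperator (unit a b κ) v) =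
    ∑ i, r.eps i κ * r.coord i v * triFun a b s (r.dual i) := by
  conv_lhs => rw [← r.sum_coord_smul_dual (toOperator (unit a b κ) v)]
  simp only [map_sum, map_smul, coord_unit, smul_eq_mul]

lemma triFun_pos {v : Space} (hv : v ∈ r.orth) (s : Bool) : 0 < triFun a b s v := by
  rw [← r.sum_coord_smul_dual v, map_sum]
  refine Finset.sum_pos (fun i _ => ?_) Finset.univ_nonempty
  rw [map_smul]
  exact smul_pos (hv i) (r.triFun_dual_pos s i)

lemma eq_zero_of_eps {κ : ℤ × ℤ} (h : ∀ i, r.eps i κ = 1) : κ = 0 := by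
  have h₀ := r.log_eps 0 κ
  have h₁ := r.log_eps 1 κ
  rw [h, Real.log_one] at h₀ h₁
  have hreg := r.regulator_pos.ne'
  have hκ₁ : (κ.1 : ℝ) = 0 := mul_right_cancel₀ hreg (by
    rw [regulator]
    linear_combination Real.log (r.t 0 + (a + 2)) * h₁ - Real.log (r.t 1 + (a + 2)) * h₀)
  have hκ₂ : (κ.2 : ℝ) = 0 := mul_right_cancel₀ hreg (by
    rw [regulator]
    linear_combination Real.log (r.t 1 ^ 2) * h₀ - Real.log (r.t 0 ^ 2) * h₁)
  exact Prod.ext (by exact_mod_cast hκ₁) (by exact_mod_cast hκ₂)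

end Roots

lemma vert_injective {a b : ℕ} : Function.Injective (vert a b) := fun κ l h => by
  obtain ⟨r⟩ := Roots.exists a b
  refine sub_eq_zero.1 (r.eq_zero_of_eps fun i => ?_)
  have hB : vert a b (κ - l) = ptB := by
    rw [sub_eq_neg_add, ← toOperator_unit_vert, h, toOperator_unit_vert, neg_add_cancel, vert_zero]
  rw [← r.coord_vert, hB, r.coord_ptB]

namespace Roots

variable {a b : ℕ} (r : Roots a b)

/-- A bound for the eigenvalues bounds the integer coordinates of the vertices. -/
lemma finite_eps_le (N : Fin 3 → ℝ) : {κ | ∀ i, r.eps i κ ≤ N i}.Finite := by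
  choose k hk using isIntegerPoint_vert (a := a) (b := b)
  have hkinj : Function.Injective k := fun κ l h =>
    vert_injective (PiLp.ext fun j => by rw [hk, hk, h])
  choose M hM using fun j => exists_int_gt (∑ i, N i * |r.dual i j|)
  refine ((Set.finite_Icc (-M) M).preimage hkinj.injOn).subset fun κ hκ => ?_
  have hbound (j : Fin 3) : |(k κ j : ℝ)| ≤ M j := by
    refine le_trans ?_ (hM j).le
    rw [← hk, ← r.sum_coord_smul_dual (vert a b κ), WithLp.ofLp_sum, Finset.sum_apply]
    refine (Finset.abs_sum_le_sum_abs _ _).trans (Finset.sum_le_sum fun i _ => ?_)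
    rw [coord_vert, PiLp.smul_apply, smul_eq_mul, abs_mul, abs_of_pos (r.eps_pos i κ)]
    exact mul_le_mul_of_nonneg_right (hκ i) (abs_nonneg _)
  have hbound' (j : Fin 3) : |k κ j| ≤ M j := by exact_mod_cast hbound j
  exact ⟨fun j => (abs_le.1 (hbound' j)).1, fun j => (abs_le.1 (hbound' j)).2⟩

lemma finite_triFun_le {v : Space} (hv : v ∈ r.orth) (c : ℝ) :
    {p : (ℤ × ℤ) × Bool | triFun a b p.2 (toOperator (unit a b p.1) v) ≤ c}.Finite := by
  have hpos (s : Bool) (i : Fin 3) : 0 < r.coord i v * triFun a b s (r.dual i) :=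
    mul_pos (hv i) (r.triFun_dual_pos s i)
  refine (Set.finite_iUnion fun s => (r.finite_eps_le fun i =>
    c / (r.coord i v * triFun a b s (r.dual i))).prod (Set.finite_singleton s)).subset ?_
  rintro ⟨κ, s⟩ hp
  refine Set.mem_iUnion.2 ⟨s, fun i => ?_, rfl⟩
  rw [le_div_iff₀ (hpos s i), ← mul_assoc]
  refine le_trans ?_ ((r.triFun_unit s κ v).symm.trans_le hp)
  refine Finset.single_le_sum (f := fun i => r.eps i κ * r.coord i v * triFun a b s (r.dual i))
    (fun j _ => ?_) (Finset.mem_univ i)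
  rw [mul_assoc]
  exact (mul_pos (r.eps_pos j κ) (hpos s j)).le

lemma exists_triFun_le {v : Space} (hv : v ∈ r.orth) : ∃ κ s, ∀ κ' s',
    triFun a b s (toOperator (unit a b κ) v) ≤ triFun a b s' (toOperator (unit a b κ') v) := by
  have h : Filter.Tendsto (fun p : (ℤ × ℤ) × Bool => triFun a b p.2 (toOperator (unit a b p.1) v))
      Filter.cofinite Filter.atTop := by
    refine Filter.tendsto_atTop.2 fun c => ?_
    filter_upwards [(r.finite_triFun_le hv c).compl_mem_cofinite] with p hp
    exact (not_le.1 fun h => hp h).le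
  obtain ⟨⟨κ, s⟩, hmin⟩ := h.exists_forall_le
  exact ⟨κ, s, fun κ' s' => hmin (κ', s')⟩

/-- Where a triangle functional attains the minimum over its orbit, the point is in the cone over
the triangle. -/
lemma exists_bar_nonneg {v : Space} (hv : v ∈ r.orth) : ∃ κ s,
    (∀ i, 0 ≤ bar a b s i (toOperator (unit a b κ) v)) ∧ ∀ κ' s',
      triFun a b s (toOperator (unit a b κ) v) ≤ triFun a b s' (toOperator (unit a b κ') v) := by
  obtain ⟨κ, s, h⟩ := r.exists_triFun_le hv
  refine ⟨κ, s, fun i => ?_, h⟩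
  refine nonneg_of_mul_nonneg_right (le_of_le_of_eq ?_ (triFun_neighbor_sub s i _))
    (sub_pos.2 (one_lt_triFun_neighbor s i))
  rw [← toOperator_unit_add]
  exact sub_nonneg.2 (h _ _)

/-- The integer points in the cone over `ABD` are on the planes of integer distance one, and
those in the cone over `BCD` are either at least at the height of `B` and `D` or on the ray of
`C`. -/
lemma one_le_triFun_of_bar_nonneg {s : Bool} {v : Space} (hv : v ∈ r.orth) (hi : IsIntegerPoint v)
    (h : ∀ i, 0 ≤ bar a b s i v) : 1 ≤ triFun a b s v := by
  have hpos := r.triFun_pos hv s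
  choose k hk using hi
  cases s
  · have ha : (a : ℝ) + 2 ≠ 0 := by positivity
    have hb : (b : ℝ) + 1 ≠ 0 := by positivity
    have hsum : triFun a b false v =
        bar a b false 0 v + (bar a b false 1 v + bar a b false 2 v) := by
      rw [triFun_apply, Fin.sum_univ_three, add_assoc]
    have hk₂ : bar a b false 1 v + bar a b false 2 v = k 2 := by
      simp [bar, linForm_apply, hk]
      field_simp
      ring
    have hk₂' : 0 ≤ k 2 := by exact_mod_cast (add_nonneg (h 1) (h 2)).trans_eq hk₂
    rcases hk₂'.eq_or_lt with h0 | h1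
    · rw [← h0, Int.cast_zero] at hk₂
      have hC : triFun a b false v = k 1 := by
        have hD : bar a b false 1 v = 0 := by linarith [h 1, h 2]
        rw [hsum, hk₂, add_zero]
        simp [bar, linForm_apply, hk] at hD ⊢
        field_simp at hD ⊢
        linear_combination - hD
      rw [hC] at hpos ⊢
      exact_mod_cast hpos
    · have h1' : (1 : ℝ) ≤ k 2 := by exact_mod_cast h1
      linarith [h 0]
  · have hint : triFun a b true v =
        ((-(a + 1) * k 0 + (a + 1) * (b + 1) * k 1 + k 2 : ℤ) : ℝ) := by
      rw [triFun_true, hk, hk, hk]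
      push_cast
      rfl
    rw [hint] at hpos ⊢
    exact_mod_cast hpos

lemma one_le_triFun {v : Space} (hv : v ∈ r.orth) (hi : IsIntegerPoint v) (s : Bool) :
    1 ≤ triFun a b s v := by
  obtain ⟨κ, s', h, hmin⟩ := r.exists_bar_nonneg hv
  refine (r.one_le_triFun_of_bar_nonneg (r.unit_mem_orth_iff.2 hv) (hi.map _) h).trans ?_
  simpa only [unit_zero, toOperator_one] using hmin 0 s

/-- The polyhedron cut out by the orbits of the functionals of the two triangles. -/
def hull : Set Space :=
  {v | v ∈ r.orth ∧ ∀ κ s, 1 ≤ triFun a b s (toOperator (unit a b κ) v)}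

lemma exists_eq_smul_tri {v : Space} (hv : v ∈ r.orth) : ∃ κ s, ∃ p ∈ tri a b s,
    toOperator (unit a b κ) v = triFun a b s (toOperator (unit a b κ) v) • p := by
  obtain ⟨κ, s, h, -⟩ := r.exists_bar_nonneg hv
  have hpos := r.triFun_pos (r.unit_mem_orth_iff (κ := κ).2 hv) s
  refine ⟨κ, s, (triFun a b s (toOperator (unit a b κ) v))⁻¹ • toOperator (unit a b κ) v,
    mem_tri_iff.2 ⟨?_, fun i => ?_⟩, (smul_inv_smul₀ hpos.ne' _).symm⟩
  · rw [map_smul, smul_eq_mul, inv_mul_cancel₀ hpos.ne']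
  · rw [map_smul]
    exact smul_nonneg (inv_nonneg.2 hpos.le) (h i)

lemma unit_mem_hull_iff {κ : ℤ × ℤ} {v : Space} :
    toOperator (unit a b κ) v ∈ r.hull ↔ v ∈ r.hull := by
  refine and_congr r.unit_mem_orth_iff ?_
  simp only [← toOperator_unit_add]
  exact (Equiv.addRight κ).forall_congr fun _ => Iff.rfl

lemma convex_hull : Convex ℝ r.hull := by
  have h : r.hull = r.orth ∩ ⋂ κ, ⋂ s,
      (triFun a b s ∘ₗ toOperator (unit a b κ)) ⁻¹' Set.Ici 1 := by
    ext v
    simp [hull]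
  rw [h]
  exact r.convex_orth.inter
    (convex_iInter fun _ => convex_iInter fun _ => (convex_Ici 1).linear_preimage _)

lemma integer_set_eq : {x | x ∈ closure r.orth ∧ IsIntegerPoint x ∧ x ≠ 0} =
    {x | x ∈ r.orth ∧ IsIntegerPoint x} := by
  ext x
  refine ⟨fun ⟨h, hi, h0⟩ => ⟨r.mem_orth_of_integer hi h0 h, hi⟩,
    fun ⟨h, hi⟩ => ⟨subset_closure h, hi, ?_⟩⟩
  rintro rfl
  simpa using h 0

lemma vert_mem_integerHull (κ : ℤ × ℤ) : vert a b κ ∈ integerHull r.orth := by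
  rw [integerHull, integer_set_eq]
  exact subset_convexHull ℝ _ ⟨r.vert_mem_orth κ, isIntegerPoint_vert κ⟩

lemma tri_subset_integerHull (s : Bool) : tri a b s ⊆ integerHull r.orth :=
  convexHull_min (by rintro - ⟨i, -, rfl⟩; exact r.vert_mem_integerHull _) (convex_convexHull ℝ _)

lemma unit_mem_integerHull {v : Space} (κ : ℤ × ℤ) (hv : v ∈ integerHull r.orth) :
    toOperator (unit a b κ) v ∈ integerHull r.orth := by
  rw [integerHull, integer_set_eq] at *
  have h := Set.mem_image_of_mem (toOperator (unit a b κ)) hv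
  rw [LinearMap.image_convexHull] at h
  refine convexHull_mono ?_ h
  rintro - ⟨x, ⟨hx, hi⟩, rfl⟩
  exact ⟨r.unit_mem_orth_iff.2 hx, hi.map _⟩

lemma smul_mem_integerHull {v : Space} (hv : v ∈ integerHull r.orth) {c : ℝ} (hc : 1 ≤ c) :
    c • v ∈ integerHull r.orth := by
  rw [integerHull, integer_set_eq] at *
  set P := {x | x ∈ r.orth ∧ IsIntegerPoint x}
  suffices h : convexHull ℝ P ⊆ (LinearMap.lsmul ℝ Space c) ⁻¹' convexHull ℝ P from h hv
  refine convexHull_min (fun x hx => ?_) ((convex_convexHull ℝ _).linear_preimage _)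
  obtain ⟨N, hN⟩ := exists_nat_gt c
  have hxN : (N : ℝ) • x ∈ P := by
    refine ⟨fun i => ?_, fun i => ?_⟩
    · rw [map_smul]
      exact smul_pos (by linarith) (hx.1 i)
    · obtain ⟨k, hk⟩ := hx.2 i
      exact ⟨N * k, by simp [hk]⟩
  have hseg : c • x ∈ (LinearMap.toSpanSingleton ℝ Space x) '' segment ℝ 1 (N : ℝ) := by
    rw [segment_eq_Icc (by linarith)]
    exact ⟨c, ⟨hc, hN.le⟩, rfl⟩
  rw [← LinearMap.coe_toAffineMap, image_segment] at hseg
  refine (convex_convexHull ℝ P).segment_subset (subset_convexHull ℝ _ hx)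
    (subset_convexHull ℝ _ hxN) ?_
  simpa using hseg

lemma integerHull_eq : integerHull r.orth = r.hull := by
  apply Set.Subset.antisymm
  · rw [integerHull, integer_set_eq]
    exact convexHull_min (fun x hx => ⟨hx.1, fun κ s =>
      r.one_le_triFun (r.unit_mem_orth_iff.2 hx.1) (hx.2.map _) s⟩) r.convex_hull
  · intro v hv
    obtain ⟨κ, s, p, hp, h⟩ := r.exists_eq_smul_tri hv.1
    have hu := r.smul_mem_integerHull (r.tri_subset_integerHull s hp) (hv.2 κ s)
    rw [← h] at hu
    rw [← toOperator_inv_apply_self (unit a b κ) v, ← unit_neg]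
    exact r.unit_mem_integerHull (-κ) hu

lemma tri_eq (s : Bool) : tri a b s = {v ∈ r.hull | triFun a b s v = 1} := by
  ext v
  refine ⟨fun h => ⟨r.integerHull_eq ▸ r.tri_subset_integerHull s h, (mem_tri_iff.1 h).1⟩,
    fun ⟨h, h1⟩ => mem_tri_iff.2 ⟨h1, fun i => ?_⟩⟩
  refine nonneg_of_mul_nonneg_right (le_of_le_of_eq ?_ (triFun_neighbor_sub s i v))
    (sub_pos.2 (one_lt_triFun_neighbor s i))
  rw [h1]
  exact sub_nonneg.2 (h.2 _ _)

lemma add_mem_hull {v w : Space} (hv : v ∈ r.hull) (hw : w ∈ r.orth) : v + w ∈ r.hull := by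
  refine ⟨fun i => ?_, fun κ s => ?_⟩
  · rw [map_add]
    exact _root_.add_pos (hv.1 i) (hw i)
  · rw [map_add, map_add]
    exact le_add_of_le_of_nonneg (hv.2 κ s) (r.triFun_pos (r.unit_mem_orth_iff.2 hw) s).le

lemma smul_mem_interior {v : Space} (hv : v ∈ r.hull) {c : ℝ} (hc : 1 < c) :
    c • v ∈ interior r.hull := by
  refine mem_interior.2 ⟨(fun w => w - v) ⁻¹' r.orth, fun w hw => ?_,
    r.isOpen_orth.preimage (continuous_id.sub continuous_const), fun i => ?_⟩
  · simpa using r.add_mem_hull hv hw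
  · have h : c * r.coord i v - r.coord i v = (c - 1) * r.coord i v := by ring
    rw [map_sub, map_smul, smul_eq_mul, h]
    exact mul_pos (sub_pos.2 hc) (hv.1 i)

lemma triFun_unit_nsmul (s : Bool) (κ : ℤ × ℤ) (n : ℕ) (v : Space) :
    triFun a b s (toOperator (unit a b (n • κ)) v) =
      ∑ i, r.eps i κ ^ n * (r.coord i v * triFun a b s (r.dual i)) := by
  have h (i : Fin 3) : r.eps i (n • κ) = r.eps i κ ^ n := by
    rw [eps, eps, mul_pow, Prod.smul_fst, Prod.smul_snd]
    simp only [nsmul_eq_mul, mul_comm (n : ℤ), zpow_mul, zpow_natCast]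
  simp only [r.triFun_unit, h, mul_assoc]

open Filter Topology in
/-- A limit point with a vanishing coordinate would be contracted to the origin by the powers of a
unit that contracts the two other coordinates. -/
lemma isClosed_hull : IsClosed r.hull := by
  refine isClosed_of_closure_subset fun x hx => ?_
  have hge (κ : ℤ × ℤ) (s : Bool) : 1 ≤ triFun a b s (toOperator (unit a b κ) x) := by
    have hc : Continuous (triFun a b s ∘ₗ toOperator (unit a b κ)) :=
      LinearMap.continuous_of_finiteDimensional _
    exact closure_minimal (fun v hv => hv.2 κ s) (isClosed_le continuous_const hc) hx
  refine ⟨fun i => (r.mem_closure_orth.1 (closure_mono (fun v hv => hv.1) hx) i).lt_of_ne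
    fun h0 => ?_, hge⟩
  obtain ⟨κ, hκ⟩ := r.exists_eps_lt_one i
  have hlim : Tendsto (fun n : ℕ => triFun a b true (toOperator (unit a b (n • κ)) x)) atTop
      (𝓝 0) := by
    simp only [r.triFun_unit_nsmul]
    rw [← Finset.sum_const_zero (s := (Finset.univ : Finset (Fin 3)))]
    refine tendsto_finsetSum _ fun j _ => ?_
    rcases eq_or_ne j i with rfl | hj
    · simp [← h0]
    · simpa using (tendsto_pow_atTop_nhds_zero_of_lt_one (r.eps_pos j κ).le (hκ j hj)).mul_const
        (r.coord j x * triFun a b true (r.dual j))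
  exact zero_lt_one.not_ge (ge_of_tendsto' hlim fun n => hge _ _)

open Filter Topology in
lemma notMem_interior_hull {v : Space} {κ : ℤ × ℤ} {s : Bool}
    (h : triFun a b s (toOperator (unit a b κ) v) = 1) : v ∉ interior r.hull := by
  intro hv
  have hlim : Tendsto (fun c : ℝ => c • v) (𝓝[<] 1) (𝓝 v) :=
    ((continuous_id.smul continuous_const).tendsto' 1 v (one_smul ℝ v)).mono_left nhdsWithin_le_nhds
  obtain ⟨c, hc, hc1⟩ := ((hlim.eventually (isOpen_interior.mem_nhds hv)).and
    self_mem_nhdsWithin).exists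
  have hge := (interior_subset hc).2 κ s
  rw [map_smul, map_smul, h, smul_eq_mul, mul_one] at hge
  exact hge.not_gt hc1

lemma sail_eq : sail r.orth =
    {v ∈ r.hull | ∃ κ s, triFun a b s (toOperator (unit a b κ) v) = 1} := by
  rw [sail, integerHull_eq, r.isClosed_hull.frontier_eq]
  ext v
  refine and_congr_right fun hv => ⟨fun hni => ?_, fun ⟨κ, s, h⟩ => r.notMem_interior_hull h⟩
  obtain ⟨κ, s, p, hp, h⟩ := r.exists_eq_smul_tri hv.1
  refine ⟨κ, s, (hv.2 κ s).antisymm' (not_lt.1 fun h1 => hni ?_)⟩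
  rw [r.tri_eq] at hp
  have hint := r.smul_mem_interior (r.unit_mem_hull_iff (κ := -κ).2 hp.1) h1
  rwa [← map_smul, ← h, unit_neg, toOperator_inv_apply_self] at hint

lemma tri_subset_sail (s : Bool) : tri a b s ⊆ sail r.orth := by
  rw [r.sail_eq, r.tri_eq]
  exact fun v ⟨hv, h⟩ => ⟨hv, 0, s, by rwa [unit_zero, toOperator_one]⟩

lemma sail_subset_hull : sail r.orth ⊆ r.hull := by
  rw [r.sail_eq]
  exact fun v hv => hv.1

lemma exists_mem_tri {v : Space} (hv : v ∈ sail r.orth) :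
    ∃ κ s, toOperator (unit a b κ) v ∈ tri a b s := by
  rw [r.sail_eq] at hv
  obtain ⟨hv, κ, s, h⟩ := hv
  exact ⟨κ, s, by rw [r.tri_eq]; exact ⟨r.unit_mem_hull_iff.2 hv, h⟩⟩

lemma unit_mem_sail {v : Space} (κ : ℤ × ℤ) (hv : v ∈ sail r.orth) :
    toOperator (unit a b κ) v ∈ sail r.orth := by
  rw [r.sail_eq] at hv ⊢
  obtain ⟨hv, μ, s, h⟩ := hv
  exact ⟨r.unit_mem_hull_iff.2 hv, μ - κ, s, by rwa [← toOperator_unit_add, sub_add_cancel]⟩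

end Roots

section Cells

variable {a b : ℕ}

/-- The positions of the vertices of a cell. -/
def cellIndex (s : Bool) (J : Finset (Fin 3)) : Finset (ℤ × ℤ) := J.image (cornerIndex s)

lemma unit_image_cell (κ : ℤ × ℤ) (s : Bool) (J : Finset (Fin 3)) :
    toOperator (unit a b κ) '' cell a b s J =
      convexHull ℝ (vert a b '' (cellIndex s J).image (κ + ·)) := by
  rw [cell, LinearMap.image_convexHull, Set.image_image]
  simp only [corner, toOperator_unit_vert, cellIndex, Finset.coe_image, Set.image_image]

lemma compl_singleton_nonempty : ∀ i : Fin 3, ({i}ᶜ : Finset (Fin 3)).Nonempty := by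
  decide

lemma neighbor_not : ∀ s i, neighbor (!s) i = -neighbor s i := by
  decide

lemma unit_image_unit_image (κ l : ℤ × ℤ) (S : Set Space) :
    toOperator (unit a b κ) '' (toOperator (unit a b l) '' S) =
      toOperator (unit a b (κ + l)) '' S := by
  simp only [Set.image_image, toOperator_unit_add]

lemma unit_zero_image (S : Set Space) : toOperator (unit a b 0) '' S = S := by
  simp [unit_zero, toOperator_one]

lemma cell_inter_cell (s : Bool) (J J' : Finset (Fin 3)) :
    cell a b s J ∩ cell a b s J' = cell a b s (J ∩ J') := by
  ext v
  simp only [Set.mem_inter_iff, mem_cell_iff, Finset.mem_inter]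
  grind

lemma corner_mem_cell {s : Bool} {J : Finset (Fin 3)} {i : Fin 3} (hi : i ∈ J) :
    corner a b s i ∈ cell a b s J :=
  subset_convexHull ℝ _ (Set.mem_image_of_mem _ hi)

lemma eq_corner_of_bar {s : Bool} {v : Space} (h1 : triFun a b s v = 1) {i : Fin 3}
    (hi : ∀ j ≠ i, bar a b s j v = 0) : v = corner a b s i := by
  rw [triFun_apply, Finset.sum_eq_single i (fun j _ hj => hi j hj) (by simp)] at h1
  rw [← sum_bar_smul_corner s v, Finset.sum_eq_single i (fun j _ hj => by rw [hi j hj, zero_smul])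
    (by simp), h1, one_smul]

lemma vert_singleton (κ : ℤ × ℤ) :
    {vert a b κ} = toOperator (unit a b κ) '' cell a b true {1} := by
  simp [cell, corner_true, vert]

lemma linearIndependent_corner (s : Bool) : LinearIndependent ℝ (corner a b s) := by
  refine Fintype.linearIndependent_iff.2 fun c hc i => ?_
  simpa [bar_corner] using congrArg (bar a b s i) hc

lemma finrank_vectorSpan_unit_image_cell (κ : ℤ × ℤ) (s : Bool) {J : Finset (Fin 3)} {k : ℕ}
    (hJ : J.card = k + 1) :
    Module.finrank ℝ (vectorSpan ℝ (toOperator (unit a b κ) '' cell a b s J)) = k := by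
  have hker : LinearMap.ker (toOperator (unit a b κ)) = ⊥ :=
    LinearMap.ker_eq_bot.2 (Function.LeftInverse.injective (toOperator_inv_apply_self _))
  rw [cell, LinearMap.image_convexHull, Set.image_image, ← direction_affineSpan,
    affineSpan_convexHull, direction_affineSpan, ← Finset.coe_image]
  exact ((linearIndependent_corner s).map' _ hker).affineIndependent.finrank_vectorSpan_image_finset
    hJ

/-- The six faces `B`, `AB`, `AD`, `BD`, `ABD`, `BCD` of the theorem. -/
def standardCells : Finset (Bool × Finset (Fin 3)) :=
  {(true, {1}), (true, {0, 1}), (true, {0, 2}), (true, {1, 2}), (true, Finset.univ),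
    (false, Finset.univ)}

lemma exists_standardCells_translate (s : Bool) {J : Finset (Fin 3)} (hJ : J.Nonempty) :
    ∃ κ, ∃ p ∈ standardCells, p.2.card = J.card ∧
      cellIndex s J = (cellIndex p.1 p.2).image (κ + ·) := by
  have h : ∀ s, ∀ J : Finset (Fin 3), J.Nonempty → ∃ p ∈ standardCells, p.2.card = J.card ∧
      ∃ x ∈ cellIndex p.1 p.2, ∃ y ∈ cellIndex s J,
        cellIndex s J = (cellIndex p.1 p.2).image (y - x + ·) := by
    decide
  obtain ⟨p, hp, hc, x, -, y, -, h⟩ := h s J hJ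
  exact ⟨y - x, p, hp, hc, h⟩

lemma standardCells_eq_of_translate {p q : Bool × Finset (Fin 3)} (hp : p ∈ standardCells)
    (hq : q ∈ standardCells) {κ : ℤ × ℤ}
    (h : cellIndex q.1 q.2 = (cellIndex p.1 p.2).image (κ + ·)) : q = p := by
  have key : ∀ p ∈ standardCells, ∀ q ∈ standardCells, ∀ x ∈ cellIndex p.1 p.2,
      ∀ y ∈ cellIndex q.1 q.2,
        cellIndex q.1 q.2 = (cellIndex p.1 p.2).image (y - x + ·) → q = p := by
    decide
  have hne : ∀ p ∈ standardCells, (cellIndex p.1 p.2).Nonempty := by decide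
  obtain ⟨x, hx⟩ := hne p hp
  refine key p hp q hq x hx (κ + x) (h ▸ Finset.mem_image_of_mem _ hx) ?_
  rwa [add_sub_cancel_right]

end Cells

/-- The contact sets of `K` with the supporting planes that separate it from the origin. -/
def IsContact (K F : Set Space) : Prop :=
  F.Nonempty ∧ ∃ l : Space →ₗ[ℝ] ℝ, (∀ v ∈ K, 1 ≤ l v) ∧ F = {v ∈ K | l v = 1}

lemma IsContact.inter {K F G : Set Space} (hF : IsContact K F) (hG : IsContact K G)
    (h : (F ∩ G).Nonempty) : IsContact K (F ∩ G) := by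
  obtain ⟨-, l, hl, rfl⟩ := hF
  obtain ⟨-, m, hm, rfl⟩ := hG
  refine ⟨h, (1 / 2 : ℝ) • (l + m), fun v hv => ?_, ?_⟩
  · simp only [LinearMap.smul_apply, LinearMap.add_apply, smul_eq_mul]
    linarith [hl v hv, hm v hv]
  · ext v
    simp only [Set.mem_inter_iff, Set.mem_ofPred_eq, LinearMap.smul_apply, LinearMap.add_apply,
      smul_eq_mul]
    exact ⟨fun ⟨⟨hv, h1⟩, _, h2⟩ => ⟨hv, by linarith⟩, fun ⟨hv, h⟩ =>
      ⟨⟨hv, by linarith [hl v hv, hm v hv]⟩, hv, by linarith [hl v hv, hm v hv]⟩⟩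

lemma IsContact.isExposed {K F : Set Space} (h : IsContact K F) : IsExposed ℝ K F := by
  obtain ⟨⟨x, hx⟩, l, hl, rfl⟩ := h
  refine fun _ => ⟨-l.toContinuousLinearMap, Set.ext fun v => and_congr_right fun hv => ?_⟩
  simp only [_root_.neg_apply, LinearMap.coe_toContinuousLinearMap', neg_le_neg_iff]
  exact ⟨fun h y hy => h ▸ hl y hy, fun h => (hl v hv).antisymm' (hx.2 ▸ h x hx.1)⟩

namespace Roots

variable {a b : ℕ} (r : Roots a b)

lemma smul_mem_hull {v : Space} (hv : v ∈ r.hull) {c : ℝ} (hc : 1 ≤ c) : c • v ∈ r.hull := by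
  rw [← r.integerHull_eq] at hv ⊢
  exact r.smul_mem_integerHull hv hc

/-- A functional that is bounded above on the sum of a set with an open cone, and that vanishes
at a point where it is maximal, is zero. -/
lemma isContact_of_isExposed {F : Set Space} (hne : F.Nonempty) (hF : F ≠ r.hull)
    (h : IsExposed ℝ r.hull F) : IsContact r.hull F := by
  obtain ⟨l, rfl⟩ := h hne
  obtain ⟨x, hx, hmax⟩ := hne
  have hle : l x ≤ 0 := by
    have h2 := hmax _ (r.smul_mem_hull hx one_le_two)
    rw [map_smul, smul_eq_mul] at h2
    linarith
  have hlt : l x < 0 := by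
    refine hle.lt_of_ne fun h0 => hF ?_
    have hloc : IsLocalMax l ((2 : ℝ) • x) := by
      filter_upwards [mem_interior_iff_mem_nhds.1 (r.smul_mem_interior hx one_lt_two)] with v hv
      rw [map_smul, h0, smul_zero, ← h0]
      exact hmax v hv
    rw [hloc.hasFDerivAt_eq_zero l.hasFDerivAt]
    simp
  refine ⟨⟨x, hx, hmax⟩, (l x)⁻¹ • l.toLinearMap, fun v hv => ?_, Set.ext fun v =>
    and_congr_right fun hv => ?_⟩
  · simp only [LinearMap.smul_apply, ContinuousLinearMap.coe_coe, smul_eq_mul]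
    rw [← div_eq_inv_mul, one_le_div_of_neg hlt]
    exact hmax v hv
  · simp only [LinearMap.smul_apply, ContinuousLinearMap.coe_coe, smul_eq_mul]
    rw [inv_mul_eq_one₀ hlt.ne]
    exact ⟨fun h => (h x hx).antisymm (hmax v hv), fun h y hy => h ▸ hmax y hy⟩

lemma isFace_iff {F : Set Space} {k : ℕ} : IsFace r.orth k F ↔
    IsContact r.hull F ∧ Module.finrank ℝ (vectorSpan ℝ F) = k := by
  rw [IsFace, integerHull_eq]
  refine ⟨fun ⟨h1, h2, h3, h4⟩ => ⟨r.isContact_of_isExposed h1 h2 h3, h4⟩,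
    fun ⟨h, h4⟩ => ⟨h.1, ?_, h.isExposed, h4⟩⟩
  obtain ⟨⟨x, hx⟩, l, -, rfl⟩ := h
  intro heq
  have h2 := r.smul_mem_hull hx.1 one_le_two
  rw [← heq] at h2
  have h2 := h2.2
  rw [map_smul, hx.2] at h2
  norm_num at h2

lemma isContact_unit_image {F : Set Space} (h : IsContact r.hull F) (κ : ℤ × ℤ) :
    IsContact r.hull (toOperator (unit a b κ) '' F) := by
  obtain ⟨h1, l, hl, rfl⟩ := h
  refine ⟨h1.image _, l ∘ₗ toOperator (unit a b (-κ)),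
    fun v hv => hl _ (r.unit_mem_hull_iff.2 hv), Set.ext fun v => ?_⟩
  rw [unit_neg]
  constructor
  · rintro ⟨w, ⟨hw, hw'⟩, rfl⟩
    exact ⟨r.unit_mem_hull_iff.2 hw, by rwa [LinearMap.comp_apply, toOperator_inv_apply_self]⟩
  · rintro ⟨hv, h⟩
    refine ⟨_, ⟨?_, h⟩, toOperator_apply_inv_self _ _⟩
    rw [← unit_neg]
    exact r.unit_mem_hull_iff.2 hv

lemma isContact_tri (s : Bool) : IsContact r.hull (tri a b s) :=
  ⟨⟨_, corner_mem_cell (Finset.mem_univ 0)⟩, triFun a b s,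
    fun v hv => by simpa [unit_zero, toOperator_one] using hv.2 0 s, r.tri_eq s⟩

lemma isContact_edge (s : Bool) (i : Fin 3) : IsContact r.hull (cell a b s {i}ᶜ) := by
  obtain ⟨j, hj⟩ := compl_singleton_nonempty i
  let l := triFun a b (!s) ∘ₗ toOperator (unit a b (neighbor s i))
  have hθ := sub_pos.2 (one_lt_triFun_neighbor (a := a) (b := b) s i)
  have hsub (v : Space) (hv : triFun a b s v = 1) : l v = 1 ↔ bar a b s i v = 0 := by
    rw [← sub_eq_zero, ← hv, LinearMap.comp_apply, triFun_neighbor_sub, mul_eq_zero,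
      or_iff_right hθ.ne']
  have hcell : cell a b s {i}ᶜ = tri a b s ∩ {v ∈ r.hull | l v = 1} := by
    ext v
    simp only [r.tri_eq, Set.mem_inter_iff, Set.mem_ofPred_eq]
    rw [mem_cell_iff]
    refine ⟨fun ⟨h1, h0, hi⟩ => ?_, fun ⟨⟨hv, h1⟩, _, hl⟩ => ?_⟩
    · have hv : v ∈ tri a b s := mem_tri_iff.2 ⟨h1, h0⟩
      rw [r.tri_eq] at hv
      exact ⟨hv, hv.1, (hsub v h1).2 (hi i (by simp))⟩
    · have hv : v ∈ tri a b s := by rw [r.tri_eq]; exact ⟨hv, h1⟩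
      refine ⟨h1, (mem_tri_iff.1 hv).2, fun k hk => ?_⟩
      rw [show k = i by simpa using hk]
      exact (hsub v h1).1 hl
  have hne : (cell a b s {i}ᶜ).Nonempty := ⟨_, corner_mem_cell hj⟩
  rw [hcell] at hne ⊢
  exact (r.isContact_tri s).inter
    ⟨hne.mono Set.inter_subset_right, l, fun v hv => hv.2 _ _, rfl⟩ hne

lemma isContact_cell (s : Bool) {J : Finset (Fin 3)} (hJ : J.Nonempty) :
    IsContact r.hull (cell a b s J) := by
  rw [← compl_compl J] at hJ ⊢
  generalize Jᶜ = K at *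
  induction K using Finset.induction_on with
  | empty => simpa using r.isContact_tri s
  | insert i K _ ih =>
    rw [Finset.insert_eq, Finset.compl_union, Finset.inter_comm, ← cell_inter_cell] at *
    obtain ⟨j, hj⟩ := hJ
    have hj' := Finset.mem_inter.1 hj
    exact (ih ⟨j, hj'.1⟩).inter (r.isContact_edge s i)
      ⟨_, corner_mem_cell hj'.1, corner_mem_cell hj'.2⟩

lemma vert_mem_extremePoints (κ : ℤ × ℤ) : vert a b κ ∈ r.hull.extremePoints ℝ := by
  have h := (r.isContact_unit_image (r.isContact_cell true (Finset.singleton_nonempty 1)) κ)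
  rw [← vert_singleton] at h
  exact h.isExposed.isExtreme.mem_extremePoints

end Roots

lemma vert_mem_unit_image_cell {a b : ℕ} {κ l : ℤ × ℤ} {s : Bool} {J : Finset (Fin 3)} :
    vert a b l ∈ toOperator (unit a b κ) '' cell a b s J ↔
      l ∈ (cellIndex s J).image (κ + ·) := by
  obtain ⟨r⟩ := Roots.exists a b
  rw [unit_image_cell]
  refine ⟨fun h => ?_, fun h => subset_convexHull ℝ _ (Set.mem_image_of_mem _ h)⟩
  have hsub : convexHull ℝ (vert a b '' (cellIndex s J).image (κ + ·)) ⊆ r.hull :=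
    convexHull_min (by rintro - ⟨k, -, rfl⟩; exact (r.vert_mem_extremePoints k).1) r.convex_hull
  have h' := extremePoints_convexHull_subset
    (inter_extremePoints_subset_extremePoints_of_subset hsub ⟨h, r.vert_mem_extremePoints l⟩)
  exact (vert_injective.mem_set_image).1 h'

lemma eq_of_unit_image_cell_eq {a b : ℕ} {κ : ℤ × ℤ} {p q : Bool × Finset (Fin 3)}
    (hp : p ∈ standardCells) (hq : q ∈ standardCells)
    (h : toOperator (unit a b κ) '' cell a b p.1 p.2 = cell a b q.1 q.2) : q = p := by
  refine standardCells_eq_of_translate hp hq (κ := κ) (Finset.ext fun l => ?_)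
  rw [← vert_mem_unit_image_cell (a := a) (b := b), h, ← unit_zero_image (cell a b q.1 q.2),
    vert_mem_unit_image_cell]
  simp

namespace Roots

variable {a b : ℕ} (r : Roots a b)

lemma setOf_triFun_unit_eq_one (κ : ℤ × ℤ) (s : Bool) :
    {v ∈ r.hull | triFun a b s (toOperator (unit a b κ) v) = 1} =
      toOperator (unit a b (-κ)) '' tri a b s := by
  ext v
  rw [r.tri_eq, unit_neg]
  constructor
  · rintro ⟨hv, h⟩
    exact ⟨_, ⟨r.unit_mem_hull_iff.2 hv, h⟩, toOperator_inv_apply_self _ _⟩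
  · rintro ⟨w, ⟨hw, h⟩, rfl⟩
    rw [← unit_neg, Set.mem_ofPred_eq, r.unit_mem_hull_iff, unit_neg, toOperator_apply_inv_self]
    exact ⟨hw, h⟩

/-- The pencil of the planes through the edge of the triangle `s` opposite to its corner `i`,
between the planes of the two triangles on this edge. -/
lemma setOf_triFun_add_eq_one (s : Bool) (i : Fin 3) {c : ℝ} (hc : 0 ≤ c)
    (hcθ : c ≤ triFun a b (!s) (vert a b (cornerIndex s i + neighbor s i)) - 1) :
    ∃ κ s' J, J.Nonempty ∧ {v ∈ r.hull | triFun a b s v + c * bar a b s i v = 1} =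
      toOperator (unit a b κ) '' cell a b s' J := by
  have hsub := triFun_neighbor_sub (a := a) (b := b) s i
  set θ := triFun a b (!s) (vert a b (cornerIndex s i + neighbor s i)) - 1
  rcases hc.eq_or_lt with rfl | hc
  · refine ⟨0, s, Finset.univ, Finset.univ_nonempty, ?_⟩
    simpa only [zero_mul, add_zero, unit_zero_image] using (r.tri_eq s).symm
  rcases hcθ.eq_or_lt with rfl | hcθ
  · refine ⟨-neighbor s i, !s, Finset.univ, Finset.univ_nonempty, ?_⟩
    simp only [← r.setOf_triFun_unit_eq_one, ← hsub, add_sub_cancel]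
  refine ⟨0, s, {i}ᶜ, compl_singleton_nonempty i, ?_⟩
  rw [unit_zero_image]
  ext v
  rw [mem_cell_iff, ← and_assoc, ← mem_tri_iff, r.tri_eq]
  simp only [Set.mem_ofPred_eq, Finset.mem_compl, Finset.mem_singleton, not_not, forall_eq]
  refine ⟨fun ⟨hv, h⟩ => ?_, fun ⟨⟨hv, h1⟩, h0⟩ => ⟨hv, by rw [h1, h0, mul_zero, add_zero]⟩⟩
  have h1 := hv.2 0 s
  have h2 := hv.2 (neighbor s i) (!s)
  rw [unit_zero, toOperator_one] at h1
  have h0 : bar a b s i v = 0 := by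
    rcases lt_trichotomy (bar a b s i v) 0 with hneg | h0 | hpos
    · nlinarith [hsub v]
    · exact h0
    · nlinarith
  rw [h0, mul_zero, add_zero] at h
  exact ⟨⟨hv, h⟩, h0⟩

lemma eq_of_corner_mem {F : Set Space} (hF : IsContact r.hull F) {s : Bool} {i : Fin 3}
    (hi : ∀ j ≠ i, corner a b s j ∈ F) : ∃ κ s' J, J.Nonempty ∧
      F = toOperator (unit a b κ) '' cell a b s' J := by
  obtain ⟨-, l, hl, rfl⟩ := hF
  set c := l (corner a b s i) - 1 with hc
  have hlv (v : Space) : l v = triFun a b s v + c * bar a b s i v := by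
    have h : l v - triFun a b s v = ∑ j, bar a b s j v * (l (corner a b s j) - 1) := by
      conv_lhs => rw [← sum_bar_smul_corner (a := a) (b := b) s v]
      simp only [map_sum, map_smul, triFun_corner, smul_eq_mul, mul_sub, Finset.sum_sub_distrib]
    rw [Finset.sum_eq_single i (fun j _ hj => by rw [(hi j hj).2, sub_self, mul_zero])
      (by simp), ← hc] at h
    linarith
  simp only [hlv]
  refine r.setOf_triFun_add_eq_one s i (sub_nonneg.2 (hl _ (r.vert_mem_extremePoints _).1)) ?_
  set w := vert a b (cornerIndex (!s) i + neighbor (!s) i)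
  have hw : toOperator (unit a b (neighbor s i)) w = corner a b (!s) i := by
    rw [toOperator_unit_vert, neighbor_not, add_comm, neg_add_cancel_right, corner]
  have hw1 : 1 < triFun a b s w := by simpa using one_lt_triFun_neighbor (a := a) (b := b) (!s) i
  have hlw := hl w (r.vert_mem_extremePoints _).1
  have hsub := triFun_neighbor_sub (a := a) (b := b) s i w
  rw [hw, triFun_corner] at hsub
  rw [hlv] at hlw
  have hθ := sub_pos.2 (one_lt_triFun_neighbor (a := a) (b := b) s i)
  have hneg : bar a b s i w < 0 := by nlinarith
  nlinarith

lemma corner_mem_of_bar_pos {F : Set Space} (hF : IsContact r.hull F) {s : Bool} {v : Space}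
    (hv : v ∈ tri a b s) (hvF : v ∈ F) {i : Fin 3} (hi : 0 < bar a b s i v) :
    corner a b s i ∈ F := by
  obtain ⟨-, l, hl, rfl⟩ := hF
  have hcorner (j : Fin 3) : corner a b s j ∈ r.hull := (r.vert_mem_extremePoints _).1
  refine ⟨hcorner i, (hl _ (hcorner i)).antisymm' (not_lt.1 fun h => ?_)⟩
  have hlt : ∑ j, bar a b s j v < ∑ j, bar a b s j v * l (corner a b s j) :=
    Finset.sum_lt_sum (fun j _ => le_mul_of_one_le_right ((mem_tri_iff.1 hv).2 j)
      (hl _ (hcorner j))) ⟨i, Finset.mem_univ i, lt_mul_of_one_lt_right hi h⟩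
  have hlv : l v = ∑ j, bar a b s j v * l (corner a b s j) := by
    conv_lhs => rw [← sum_bar_smul_corner (a := a) (b := b) s v]
    simp only [map_sum, map_smul, smul_eq_mul]
  rw [← triFun_apply, (mem_tri_iff.1 hv).1, ← hlv, hvF.2] at hlt
  exact hlt.false

lemma eq_corner_of_mem_tri {F : Set Space} (hF : IsContact r.hull F) {s : Bool}
    (hs : ∀ i, ∃ j ≠ i, corner a b s j ∉ F) {v : Space} (hv : v ∈ tri a b s) (hvF : v ∈ F) :
    ∃ i, v = corner a b s i := by
  obtain ⟨h1, h0⟩ := mem_tri_iff.1 hv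
  have hpos : ∃ i, 0 < bar a b s i v := by
    by_contra! hle
    rw [triFun_apply] at h1
    linarith [Finset.sum_nonpos fun i (_ : i ∈ Finset.univ) => hle i]
  obtain ⟨i, hi⟩ := hpos
  refine ⟨i, eq_corner_of_bar h1 fun j hj => (h0 j).antisymm' (not_lt.1 fun hpos => ?_)⟩
  obtain ⟨k, hk⟩ : ∃ k, ∀ m ≠ k, m = i ∨ m = j := by
    clear hpos hi
    revert i j
    decide
  obtain ⟨m, hm, hmF⟩ := hs k
  rcases hk m hm with rfl | rfl
  exacts [hmF (r.corner_mem_of_bar_pos hF hv hvF hi), hmF (r.corner_mem_of_bar_pos hF hv hvF hpos)]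

lemma subset_sail_of_isContact {F : Set Space} (h : IsContact r.hull F) : F ⊆ sail r.orth := by
  obtain ⟨-, l, hl, rfl⟩ := h
  rintro v ⟨hv, hlv⟩
  rw [sail, r.integerHull_eq, r.isClosed_hull.frontier_eq]
  refine ⟨hv, fun hint => ?_⟩
  have hloc : IsLocalMin l.toContinuousLinearMap v := by
    filter_upwards [mem_interior_iff_mem_nhds.1 hint] with w hw
    exact hlv.trans_le (hl w hw)
  have h0 := hloc.hasFDerivAt_eq_zero l.toContinuousLinearMap.hasFDerivAt
  have h1 : l.toContinuousLinearMap v = 1 := hlv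
  rw [h0] at h1
  simp at h1

/-- A contact set without two corners of the same triangle consists of vertices, and it contains
only one of them, since the midpoint of two vertices is not extreme. -/
lemma exists_eq_unit_image_cell {F : Set Space} (hF : IsContact r.hull F) :
    ∃ κ s J, J.Nonempty ∧ F = toOperator (unit a b κ) '' cell a b s J := by
  by_cases h : ∃ κ s i, ∀ j ≠ i, corner a b s j ∈ toOperator (unit a b κ) '' F
  · obtain ⟨κ, s, i, h⟩ := h
    obtain ⟨κ', s', J, hJ, h'⟩ := r.eq_of_corner_mem (r.isContact_unit_image hF κ) h
    refine ⟨-κ + κ', s', J, hJ, ?_⟩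
    rw [← unit_image_unit_image, ← h', unit_image_unit_image, neg_add_cancel, unit_zero_image]
  push Not at h
  have hvert {v : Space} (hv : v ∈ F) : ∃ κ, v = vert a b κ := by
    obtain ⟨κ, s, hκ⟩ := r.exists_mem_tri (r.subset_sail_of_isContact hF hv)
    obtain ⟨i, hi⟩ := r.eq_corner_of_mem_tri (r.isContact_unit_image hF κ) (h κ s) hκ
      (Set.mem_image_of_mem _ hv)
    refine ⟨-κ + cornerIndex s i, ?_⟩
    rw [← toOperator_unit_vert, ← corner, ← hi, unit_neg, toOperator_inv_apply_self]
  obtain ⟨v, hv⟩ := hF.1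
  obtain ⟨κ, hκ⟩ := hvert hv
  refine ⟨κ, true, {1}, Finset.singleton_nonempty 1, ?_⟩
  rw [← vert_singleton, ← hκ]
  refine Set.Subset.antisymm (fun w hw => ?_) (Set.singleton_subset_iff.2 hv)
  obtain ⟨l, hl⟩ := hvert ((hF.isExposed.convex r.convex_hull).midpoint_mem hv hw)
  have hmid := (mem_extremePoints_iff_forall_segment.1 (r.vert_mem_extremePoints l)).2
    v (hF.isExposed.subset hv) w (hF.isExposed.subset hw)
  rw [← hl] at hmid
  rcases hmid (midpoint_mem_segment v w) with h | h
  exacts [((left_eq_midpoint_iff ℝ).1 h).symm, ((right_eq_midpoint_iff ℝ).1 h).symm]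

lemma isFace_iff_exists {k : ℕ} {F : Set Space} : IsFace r.orth k F ↔
    ∃ κ, ∃ p ∈ standardCells, p.2.card = k + 1 ∧
      F = toOperator (unit a b κ) '' cell a b p.1 p.2 := by
  rw [r.isFace_iff]
  refine ⟨fun ⟨hF, hk⟩ => ?_, ?_⟩
  · obtain ⟨κ, s, J, hJ, rfl⟩ := r.exists_eq_unit_image_cell hF
    obtain ⟨l, p, hp, hcard, hpJ⟩ := exists_standardCells_translate s hJ
    have hJk := hJ.card_pos
    rw [finrank_vectorSpan_unit_image_cell κ s (k := J.card - 1) (by lia)] at hk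
    refine ⟨κ + l, p, hp, by lia, ?_⟩
    rw [unit_image_cell, unit_image_cell, hpJ, Finset.image_image]
    simp only [Function.comp_def, add_assoc]
  · rintro ⟨κ, p, -, hcard, rfl⟩
    have hJ : p.2.Nonempty := Finset.card_pos.1 (by lia)
    exact ⟨r.isContact_unit_image (r.isContact_cell p.1 hJ) κ,
      finrank_vectorSpan_unit_image_cell κ p.1 hcard⟩

end Roots

/-- The operator `toOperator g` as a linear automorphism. -/
def operatorEquiv (g : SL(3, ℤ)) : Space ≃ₗ[ℝ] Space :=
  { toOperator g with
    invFun := toOperator g⁻¹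
    left_inv := toOperator_inv_apply_self g
    right_inv := toOperator_apply_inv_self g }

lemma image_toOperator_eq_of_subset {G : Subgroup SL(3, ℤ)} {S : Set Space}
    (h : ∀ g ∈ G, toOperator g '' S ⊆ S) {g : SL(3, ℤ)} (hg : g ∈ G) : toOperator g '' S = S := by
  refine (h g hg).antisymm fun v hv => ⟨toOperator g⁻¹ v, h _ (inv_mem hg) ⟨v, hv, rfl⟩, ?_⟩
  exact toOperator_apply_inv_self g v

namespace Roots

variable {a b : ℕ} (r : Roots a b)

lemma unit_mem_periodGroup (κ : ℤ × ℤ) : unit a b κ ∈ periodGroup (frob a b) r.orth := by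
  refine ⟨commute_unit_frob κ, Set.Subset.antisymm ?_ fun v hv => ?_⟩
  · rintro - ⟨v, hv, rfl⟩
    exact r.unit_mem_sail κ hv
  · refine ⟨_, r.unit_mem_sail (-κ) hv, ?_⟩
    rw [unit_neg, toOperator_apply_inv_self]

lemma exists_eq_smul_sail {v : Space} (hv : v ∈ r.hull) :
    ∃ c : ℝ, 1 ≤ c ∧ ∃ x ∈ sail r.orth, v = c • x := by
  obtain ⟨κ, s, p, hp, h⟩ := r.exists_eq_smul_tri hv.1
  refine ⟨_, hv.2 κ s, _, r.unit_mem_sail (-κ) (r.tri_subset_sail s hp), ?_⟩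
  rw [← map_smul, ← h, unit_neg, toOperator_inv_apply_self]

lemma image_hull {g : SL(3, ℤ)} (hg : g ∈ periodGroup (frob a b) r.orth) :
    toOperator g '' r.hull = r.hull := by
  refine image_toOperator_eq_of_subset (fun g hg => ?_) hg
  rintro - ⟨v, hv, rfl⟩
  obtain ⟨c, hc, x, hx, rfl⟩ := r.exists_eq_smul_sail hv
  rw [map_smul]
  exact r.smul_mem_hull (r.sail_subset_hull (hg.2 ▸ Set.mem_image_of_mem _ hx)) hc

lemma mem_extremePoints_of_mem_periodGroup {g : SL(3, ℤ)}
    (hg : g ∈ periodGroup (frob a b) r.orth) {v : Space} (hv : v ∈ r.hull.extremePoints ℝ) :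
    toOperator g v ∈ r.hull.extremePoints ℝ := by
  rw [← r.image_hull hg]
  exact image_extremePoints (operatorEquiv g) r.hull ▸ Set.mem_image_of_mem _ hv

lemma exists_apply_ptB_eq_vert {g : SL(3, ℤ)} (hg : g ∈ periodGroup (frob a b) r.orth) :
    ∃ κ, toOperator g ptB = vert a b κ := by
  have hB : ptB ∈ tri a b true := by
    have h := corner_mem_cell (a := a) (b := b) (s := true) (Finset.mem_univ 1)
    rwa [corner_true] at h
  obtain ⟨κ, s, hκ⟩ := r.exists_mem_tri (hg.2 ▸ Set.mem_image_of_mem _ (r.tri_subset_sail _ hB))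
  have hext : toOperator (unit a b κ * g) ptB ∈ r.hull.extremePoints ℝ := by
    refine r.mem_extremePoints_of_mem_periodGroup (mul_mem (r.unit_mem_periodGroup κ) hg) ?_
    exact vert_zero (a := a) (b := b) ▸ r.vert_mem_extremePoints 0
  rw [toOperator_mul] at hext
  obtain ⟨i, -, hi⟩ := extremePoints_convexHull_subset
    (inter_extremePoints_subset_extremePoints_of_subset
      ((r.tri_subset_sail s).trans r.sail_subset_hull) ⟨hκ, hext⟩)
  refine ⟨-κ + cornerIndex s i, ?_⟩
  rw [← toOperator_unit_vert, ← corner, hi, unit_neg, toOperator_inv_apply_self]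

lemma mem_periodGroup_iff {g : SL(3, ℤ)} :
    g ∈ periodGroup (frob a b) r.orth ↔ ∃ κ, g = unit a b κ := by
  refine ⟨fun hg => ?_, fun ⟨κ, h⟩ => h ▸ r.unit_mem_periodGroup κ⟩
  obtain ⟨κ, hκ⟩ := r.exists_apply_ptB_eq_vert hg
  refine ⟨κ, (inv_mul_eq_one.1 (eq_one_of_commute (a := a) (b := b)
    ((commute_unit_frob κ).inv_left.mul_left hg.1) ?_)).symm⟩
  rw [toOperator_mul, hκ, vert, toOperator_inv_apply_self]

lemma periodGroup_eq_closure :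
    periodGroup (frob a b) r.orth = Subgroup.closure {unitX a b, unitY a b} := by
  refine le_antisymm (fun g hg => ?_) ((Subgroup.closure_le _).2 ?_)
  · obtain ⟨κ, rfl⟩ := r.mem_periodGroup_iff.1 hg
    exact mul_mem (zpow_mem (Subgroup.subset_closure (by simp)) _)
      (zpow_mem (inv_mem (Subgroup.subset_closure (by simp))) _)
  · rintro g (rfl | rfl)
    · exact r.mem_periodGroup_iff.2 ⟨(1, 0), by simp [unit]⟩
    · exact r.mem_periodGroup_iff.2 ⟨(0, -1), by simp [unit]⟩

end Roots

lemma eq_zero_of_unitX_zpow_mul_unitY_zpow {a b : ℕ} {i j : ℤ}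
    (h : unitX a b ^ i * unitY a b ^ j = 1) : i = 0 ∧ j = 0 := by
  have hunit : unit a b (i, -j) = 1 := by simpa [unit] using h
  have hvert : vert a b (i, -j) = vert a b 0 := by rw [vert, hunit, vert, unit_zero]
  simpa using vert_injective hvert

/-! ### The logarithmic space -/

lemma addCircle_coe_eq_iff {x y : ℝ} : (x : UnitAddCircle) = y ↔ ∃ k : ℤ, k + x = y := by
  rw [eq_comm, ← sub_eq_zero, ← AddCircle.coe_sub, AddCircle.coe_eq_zero_iff]
  refine exists_congr fun k => ?_
  rw [zsmul_one, eq_sub_iff_add_eq]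

/-- The point of the plane with the given integer coordinates. -/
def latticePoint (κ : ℤ × ℤ) : ℝ × ℝ := (κ.1, κ.2)

lemma latticePoint_add (κ l : ℤ × ℤ) :
    latticePoint (κ + l) = latticePoint κ + latticePoint l := by
  simp [latticePoint]

lemma toTorus_eq_iff {z w : ℝ × ℝ} :
    toTorus z = toTorus w ↔ ∃ κ : ℤ × ℤ, latticePoint κ + z = w := by
  simp only [toTorus, addCircle_coe_eq_iff, latticePoint, Prod.ext_iff,
    Prod.fst_add, Prod.snd_add, Prod.exists, exists_and_left, exists_and_right]

lemma image_toTorus_translate (κ : ℤ × ℤ) (S : Set (ℝ × ℝ)) :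
    toTorus '' ((latticePoint κ + ·) '' S) = toTorus '' S := by
  rw [Set.image_image]
  exact Set.image_congr fun z _ => (toTorus_eq_iff.2 ⟨κ, rfl⟩).symm

lemma continuous_toTorus : Continuous toTorus :=
  ((AddCircle.continuous_mk' 1).comp continuous_fst).prodMk
    ((AddCircle.continuous_mk' 1).comp continuous_snd)

namespace Roots

variable {a b : ℕ} (r : Roots a b)

lemma prod_sub (x : ℝ) :
    ∏ i, (x - r.t i) = x * (x + (a + 2)) * (x - (b + 1)) - 1 := by
  have h01 := sub_ne_zero.2 (r.t_injective.ne (by decide : (0 : Fin 3) ≠ 1))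
  have h02 := sub_ne_zero.2 (r.t_injective.ne (by decide : (0 : Fin 3) ≠ 2))
  have h12 := sub_ne_zero.2 (r.t_injective.ne (by decide : (1 : Fin 3) ≠ 2))
  rw [Fin.prod_univ_three]
  apply mul_left_cancel₀ (mul_ne_zero (mul_ne_zero h01 h02) h12)
  linear_combination - (x - r.t 1) * (x - r.t 2) * (r.t 1 - r.t 2) * r.eq 0 +
    (x - r.t 0) * (x - r.t 2) * (r.t 0 - r.t 2) * r.eq 1 -
    (x - r.t 0) * (x - r.t 1) * (r.t 0 - r.t 1) * r.eq 2

lemma sum_log_sq : ∑ i, Real.log (r.t i ^ 2) = 0 := by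
  have h := r.prod_sub 0
  rw [← Real.log_prod fun i _ => (r.sq_pos i).ne', Finset.prod_pow]
  simp only [Fin.prod_univ_three] at h ⊢
  rw [show r.t 0 * r.t 1 * r.t 2 = 1 by linear_combination -h, one_pow, Real.log_one]

lemma sum_log_add : ∑ i, Real.log (r.t i + (a + 2)) = 0 := by
  have h := r.prod_sub (-(a + 2))
  rw [← Real.log_prod fun i _ => (r.add_pos i).ne']
  simp only [Fin.prod_univ_three] at h ⊢
  rw [show (r.t 0 + (a + 2)) * (r.t 1 + (a + 2)) * (r.t 2 + (a + 2)) = 1 by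
    linear_combination -h, Real.log_one]

/-- The logarithm of an eigencoordinate, made homogeneous of degree zero. -/
def logCoord (i : Fin 3) (v : Space) : ℝ :=
  Real.log (r.coord i v) - (∑ j, Real.log (r.coord j v)) / 3

lemma logCoord_unit (i : Fin 3) (κ : ℤ × ℤ) {v : Space} (hv : v ∈ r.orth) :
    r.logCoord i (toOperator (unit a b κ) v) =
      κ.1 * Real.log (r.t i ^ 2) + κ.2 * Real.log (r.t i + (a + 2)) + r.logCoord i v := by
  have hlog (j : Fin 3) : Real.log (r.coord j (toOperator (unit a b κ) v)) =
      κ.1 * Real.log (r.t j ^ 2) + κ.2 * Real.log (r.t j + (a + 2)) + Real.log (r.coord j v) := by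
    rw [coord_unit, Real.log_mul (r.eps_pos j κ).ne' (hv j).ne', log_eps]
  simp only [logCoord, hlog, Finset.sum_add_distrib, ← Finset.mul_sum, sum_log_sq, sum_log_add]
  ring

lemma sum_logCoord (v : Space) : ∑ i, r.logCoord i v = 0 := by
  simp only [logCoord, Fin.sum_univ_three]
  ring

lemma continuousOn_logCoord (i : Fin 3) : ContinuousOn (r.logCoord i) r.orth := by
  have hlog (j : Fin 3) : ContinuousOn (fun v => Real.log (r.coord j v)) r.orth :=
    (r.continuous_coord j).continuousOn.log fun v hv => (hv j).ne'
  exact (hlog i).sub ((continuousOn_finsetSum _ fun j _ => hlog j).div_const 3)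

/-- The logarithmic coordinates with respect to the basis of the lattice of the logarithms of the
units, found by Cramer's rule. -/
def logMap (v : Space) : ℝ × ℝ :=
  ((Real.log (r.t 1 + (a + 2)) * r.logCoord 0 v - Real.log (r.t 0 + (a + 2)) * r.logCoord 1 v) /
      r.regulator,
    (Real.log (r.t 0 ^ 2) * r.logCoord 1 v - Real.log (r.t 1 ^ 2) * r.logCoord 0 v) / r.regulator)

lemma continuousOn_logMap : ContinuousOn r.logMap r.orth := by
  have h0 := r.continuousOn_logCoord 0
  have h1 := r.continuousOn_logCoord 1
  unfold logMap
  fun_prop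

lemma logMap_unit (κ : ℤ × ℤ) {v : Space} (hv : v ∈ r.orth) :
    r.logMap (toOperator (unit a b κ) v) = latticePoint κ + r.logMap v := by
  have hreg := r.regulator_pos.ne'
  simp only [logMap, r.logCoord_unit _ κ hv, latticePoint, Prod.mk_add_mk, Prod.mk.injEq]
  constructor <;> field_simp <;> rw [regulator] <;> ring

lemma logCoord_eq_of_logMap_eq {v w : Space} (h : r.logMap v = r.logMap w) (i : Fin 3) :
    r.logCoord i v = r.logCoord i w := by
  have hreg := r.regulator_pos.ne'
  obtain ⟨h1, h2⟩ := Prod.mk.inj h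
  rw [div_left_inj' hreg] at h1 h2
  have h₀ : r.logCoord 0 v = r.logCoord 0 w := by
    apply mul_left_cancel₀ hreg
    rw [regulator]
    linear_combination Real.log (r.t 0 ^ 2) * h1 + Real.log (r.t 0 + (a + 2)) * h2
  have h₁ : r.logCoord 1 v = r.logCoord 1 w := by
    apply mul_left_cancel₀ hreg
    rw [regulator]
    linear_combination Real.log (r.t 1 ^ 2) * h1 + Real.log (r.t 1 + (a + 2)) * h2
  match i with
  | 0 => exact h₀
  | 1 => exact h₁
  | 2 =>
    have hv := r.sum_logCoord v
    have hw := r.sum_logCoord w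
    rw [Fin.sum_univ_three] at hv hw
    linarith

lemma exists_smul_of_logMap_eq {v w : Space} (hv : v ∈ r.orth) (hw : w ∈ r.orth)
    (h : r.logMap v = r.logMap w) : ∃ c : ℝ, v = c • w := by
  refine ⟨Real.exp ((∑ j, Real.log (r.coord j v)) / 3 - (∑ j, Real.log (r.coord j w)) / 3),
    r.eq_of_coord fun i => ?_⟩
  have hi := r.logCoord_eq_of_logMap_eq h i
  rw [logCoord, logCoord] at hi
  rw [map_smul, smul_eq_mul, ← Real.exp_log (hv i), ← Real.exp_log (hw i), ← Real.exp_add,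
    Real.exp_eq_exp]
  linarith

lemma eq_of_eq_smul_of_mem_sail {v w : Space} (hv : v ∈ sail r.orth) (hw : w ∈ sail r.orth)
    {c : ℝ} (h : v = c • w) : v = w := by
  rw [sail_eq] at hv hw
  obtain ⟨hv, κ, s, h1⟩ := hv
  obtain ⟨hw, μ, s', h2⟩ := hw
  have h3 := hv.2 μ s'
  have h4 := hw.2 κ s
  rw [h, map_smul, map_smul, smul_eq_mul] at h1 h3
  rw [h2, mul_one] at h3
  have : c = 1 := by nlinarith
  rw [h, this, one_smul]

/-! ### The factor of the sail -/

lemma sail_subset_orth : sail r.orth ⊆ r.orth := fun _ hv => (r.sail_subset_hull hv).1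

lemma mk_eq_mk_iff {v w : sail r.orth} :
    (Quotient.mk (periodSetoid (frob a b) r.orth) v = Quotient.mk _ w) ↔
      ∃ κ, toOperator (unit a b κ) v = (w : Space) := by
  rw [Quotient.eq]
  constructor
  · rintro ⟨g, hg, h⟩
    obtain ⟨κ, rfl⟩ := r.mem_periodGroup_iff.1 hg
    exact ⟨κ, h⟩
  · rintro ⟨κ, h⟩
    exact ⟨_, r.mem_periodGroup_iff.2 ⟨κ, rfl⟩, h⟩

lemma mk_eq_mk_iff_logMap {v w : sail r.orth} :
    (Quotient.mk (periodSetoid (frob a b) r.orth) v = Quotient.mk _ w) ↔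
      toTorus (r.logMap v) = toTorus (r.logMap w) := by
  rw [mk_eq_mk_iff, toTorus_eq_iff]
  refine exists_congr fun κ => ?_
  have hκ := r.unit_mem_sail κ v.2
  rw [← r.logMap_unit κ (r.sail_subset_orth v.2)]
  refine ⟨fun h => by rw [h], fun h => ?_⟩
  obtain ⟨c, hc⟩ := r.exists_smul_of_logMap_eq (r.sail_subset_orth hκ) (r.sail_subset_orth w.2) h
  exact r.eq_of_eq_smul_of_mem_sail hκ w.2 hc

instance : T2Space (SailFactor (frob a b) r.orth) := by
  let f : SailFactor (frob a b) r.orth → UnitAddCircle × UnitAddCircle :=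
    Quotient.lift (fun v => toTorus (r.logMap v)) fun v w h =>
      r.mk_eq_mk_iff_logMap.1 (Quotient.sound h)
  have hcont : Continuous f := Continuous.quotient_lift (continuous_toTorus.comp
    (r.continuousOn_logMap.comp_continuous continuous_subtype_val
      fun v => r.sail_subset_orth v.2)) _
  have hinj : f.Injective := fun x y => Quotient.inductionOn₂ x y fun v w h =>
    r.mk_eq_mk_iff_logMap.2 h
  exact T2Space.of_injective_continuous hinj hcont

end Roots

/-! ### Barycentric coordinates on the lattice of the vertices -/

section Weights

variable {a b : ℕ}

/-- The point of a triangle with given barycentric coordinates. -/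
def spatial (a b : ℕ) (s : Bool) : (Fin 3 → ℝ) →ₗ[ℝ] Space :=
  Fintype.linearCombination ℝ (corner a b s)

/-- The point with given barycentric coordinates of a half of the unit square. -/
def planar (s : Bool) : (Fin 3 → ℝ) →ₗ[ℝ] ℝ × ℝ :=
  Fintype.linearCombination ℝ fun i => latticePoint (cornerIndex s i)

/-- The barycentric coordinates of a point of the translate by `κ` of a triangle, as weights of
the vertices of the lattice. They are common to the sail and to the triangulated plane. -/
def weights (κ : ℤ × ℤ) (s : Bool) (w : Fin 3 → ℝ) : ℤ × ℤ →₀ ℝ :=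
  ∑ i, Finsupp.single (κ + cornerIndex s i) (w i)

lemma spatial_apply (s : Bool) (w : Fin 3 → ℝ) :
    spatial a b s w = ∑ i, w i • corner a b s i := by
  rw [spatial, Fintype.linearCombination_apply]

lemma planar_apply (s : Bool) (w : Fin 3 → ℝ) :
    planar s w = ∑ i, w i • latticePoint (cornerIndex s i) := by
  rw [planar, Fintype.linearCombination_apply]

lemma bar_spatial (s : Bool) (i : Fin 3) (w : Fin 3 → ℝ) :
    bar a b s i (spatial a b s w) = w i := by
  simp [spatial_apply, bar_corner]

lemma spatial_mem_tri (s : Bool) {w : Fin 3 → ℝ} (hw : w ∈ stdSimplex ℝ (Fin 3)) :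
    spatial a b s w ∈ tri a b s := by
  simp only [mem_tri_iff, triFun_apply, bar_spatial]
  exact ⟨hw.2, hw.1⟩

lemma linearCombination_vert_weights (κ : ℤ × ℤ) (s : Bool) (w : Fin 3 → ℝ) :
    Finsupp.linearCombination ℝ (vert a b) (weights κ s w) =
      toOperator (unit a b κ) (spatial a b s w) := by
  simp only [weights, spatial_apply, map_sum, map_smul, Finsupp.linearCombination_single, corner,
    toOperator_unit_vert]

lemma linearCombination_latticePoint_weights (κ : ℤ × ℤ) (s : Bool) {w : Fin 3 → ℝ}
    (hw : w ∈ stdSimplex ℝ (Fin 3)) :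
    Finsupp.linearCombination ℝ latticePoint (weights κ s w) = latticePoint κ + planar s w := by
  simp only [weights, planar_apply, map_sum, Finsupp.linearCombination_single, latticePoint_add,
    smul_add, Finset.sum_add_distrib, ← Finset.sum_smul, hw.2, one_smul]

lemma weights_apply_add_cornerIndex (κ : ℤ × ℤ) (s : Bool) (w : Fin 3 → ℝ) (i : Fin 3) :
    weights κ s w (κ + cornerIndex s i) = w i := by
  simp [weights, Finsupp.single_apply, (cornerIndex_injective s).eq_iff]

lemma weights_apply_of_forall_ne {κ μ : ℤ × ℤ} {s : Bool} (w : Fin 3 → ℝ)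
    (hμ : ∀ i, κ + cornerIndex s i ≠ μ) : weights κ s w μ = 0 := by
  simp [weights, hμ]

end Weights

/-- The piecewise linear function on the triangulated plane that equals `1` at the origin and `0`
at the other lattice points. -/
def hat (z : ℝ × ℝ) : ℝ := max 0 (1 - max (max |z.1| |z.2|) |z.1 - z.2|)

lemma hat_eq_zero {z : ℝ × ℝ} (h : 1 ≤ |z.1| ∨ 1 ≤ |z.2| ∨ 1 ≤ |z.1 - z.2|) : hat z = 0 :=
  max_eq_left (sub_nonpos.2 (by rwa [le_max_iff, le_max_iff, or_assoc]))

lemma hat_planar_sub_cornerIndex {w : Fin 3 → ℝ} (hw : w ∈ stdSimplex ℝ (Fin 3)) (s : Bool)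
    (i : Fin 3) : hat (planar s w - latticePoint (cornerIndex s i)) = w i := by
  obtain ⟨h0, h1⟩ := hw
  rw [Fin.sum_univ_three] at h1
  have h₀ := h0 0
  have h₁ := h0 1
  have h₂ := h0 2
  cases s <;> fin_cases i <;>
    simp [planar_apply, Fin.sum_univ_three, cornerIndex, latticePoint, hat] <;> grind

lemma hat_planar_sub_latticePoint {w : Fin 3 → ℝ} (hw : w ∈ stdSimplex ℝ (Fin 3)) {s : Bool}
    {μ : ℤ × ℤ} (hμ : ∀ i, cornerIndex s i ≠ μ) : hat (planar s w - latticePoint μ) = 0 := by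
  obtain ⟨h0, h1⟩ := hw
  rw [Fin.sum_univ_three] at h1
  have h₀ := h0 0
  have h₁ := h0 1
  have h₂ := h0 2
  obtain ⟨m, n⟩ := μ
  have hcast (k : ℤ) : (k : ℝ) ≤ -1 ∨ k = 0 ∨ k = 1 ∨ (2 : ℝ) ≤ k := by
    norm_cast
    omega
  refine hat_eq_zero ?_
  simp only [planar_apply, Fin.sum_univ_three, cornerIndex, latticePoint, le_abs]
  cases s <;> rcases hcast m with hm | rfl | rfl | hm <;>
    rcases hcast n with hn | rfl | rfl | hn <;>
    simp [Fin.forall_fin_succ, cornerIndex] at hμ ⊢ <;> grind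

lemma weights_apply_eq_hat {w : Fin 3 → ℝ} (hw : w ∈ stdSimplex ℝ (Fin 3)) (κ μ : ℤ × ℤ)
    (s : Bool) : weights κ s w μ = hat (latticePoint κ + planar s w - latticePoint μ) := by
  obtain ⟨l, rfl⟩ : ∃ l, μ = κ + l := ⟨μ - κ, by abel⟩
  rw [latticePoint_add, add_sub_add_left_eq_sub]
  by_cases h : ∃ i, cornerIndex s i = l
  · obtain ⟨i, rfl⟩ := h
    rw [weights_apply_add_cornerIndex, hat_planar_sub_cornerIndex hw]
  · push Not at h
    rw [hat_planar_sub_latticePoint hw h]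
    exact weights_apply_of_forall_ne w fun i => by simpa using h i

lemma weights_eq_iff_planar {w w' : Fin 3 → ℝ} (hw : w ∈ stdSimplex ℝ (Fin 3))
    (hw' : w' ∈ stdSimplex ℝ (Fin 3)) {κ : ℤ × ℤ} {s s' : Bool} :
    weights κ s w = weights 0 s' w' ↔ latticePoint κ + planar s w = planar s' w' := by
  have h0 : planar s' w' = latticePoint 0 + planar s' w' := by simp [latticePoint]
  rw [h0]
  refine ⟨fun h => ?_, fun h => Finsupp.ext fun μ => ?_⟩
  · rw [← linearCombination_latticePoint_weights κ s hw,
      ← linearCombination_latticePoint_weights 0 s' hw', h]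
  · rw [weights_apply_eq_hat hw, weights_apply_eq_hat hw', h]

lemma exists_add_cornerIndex_eq {a b : ℕ} {w : Fin 3 → ℝ} (hw : w ∈ stdSimplex ℝ (Fin 3))
    {κ : ℤ × ℤ} {s s' : Bool} (h : toOperator (unit a b κ) (spatial a b s w) ∈ tri a b s')
    {i : Fin 3} (hi : w i ≠ 0) : ∃ j, cornerIndex s' j = κ + cornerIndex s i := by
  obtain ⟨r⟩ := Roots.exists a b
  have hmem : spatial a b s w ∈ toOperator (unit a b (-κ)) '' tri a b s' :=
    ⟨_, h, by rw [unit_neg, toOperator_inv_apply_self]⟩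
  have hcorner := r.corner_mem_of_bar_pos (r.isContact_unit_image (r.isContact_tri s') (-κ))
    (spatial_mem_tri s hw) hmem (i := i) (by rw [bar_spatial]; exact (hw.1 i).lt_of_ne' hi)
  rw [corner, vert_mem_unit_image_cell] at hcorner
  simp only [cellIndex, Finset.mem_image, Finset.mem_univ, true_and, exists_exists_eq_and]
    at hcorner
  obtain ⟨j, hj⟩ := hcorner
  exact ⟨j, by rw [← hj]; abel⟩

lemma weights_eq_iff_spatial {a b : ℕ} {w w' : Fin 3 → ℝ} (hw : w ∈ stdSimplex ℝ (Fin 3))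
    (hw' : w' ∈ stdSimplex ℝ (Fin 3)) {κ : ℤ × ℤ} {s s' : Bool} :
    weights κ s w = weights 0 s' w' ↔
      toOperator (unit a b κ) (spatial a b s w) = spatial a b s' w' := by
  have h0 : spatial a b s' w' = toOperator (unit a b 0) (spatial a b s' w') := by
    rw [unit_zero, toOperator_one]
  refine ⟨fun h => ?_, fun h => ?_⟩
  · rw [h0, ← linearCombination_vert_weights, ← linearCombination_vert_weights, h]
  let L : Space →ₗ[ℝ] ℤ × ℤ →₀ ℝ :=
    ∑ j, (bar a b s' j).smulRight (Finsupp.single (cornerIndex s' j) 1)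
  have hL (j : Fin 3) : L (vert a b (cornerIndex s' j)) = Finsupp.single (cornerIndex s' j) 1 := by
    rw [← corner]
    simp [L, bar_corner, apply_ite (Finsupp.single _)]
  have hw'L : L (spatial a b s' w') = weights 0 s' w' := by
    simp [spatial_apply, corner, hL, weights]
  have hwL : L (toOperator (unit a b κ) (spatial a b s w)) = weights κ s w := by
    rw [← linearCombination_vert_weights, weights, map_sum, map_sum]
    refine Finset.sum_congr rfl fun i _ => ?_
    rw [Finsupp.linearCombination_single, map_smul]
    rcases eq_or_ne (w i) 0 with hi | hi
    · rw [hi, zero_smul, Finsupp.single_zero]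
    · obtain ⟨j, hj⟩ := exists_add_cornerIndex_eq hw (h ▸ spatial_mem_tri s' hw') hi
      rw [← hj, hL, Finsupp.smul_single_one]
  rw [← hwL, h, hw'L]

/-! ### The torus triangulation -/

lemma exists_toTorus_planar (p : UnitAddCircle × UnitAddCircle) :
    ∃ s, ∃ w ∈ stdSimplex ℝ (Fin 3), toTorus (planar s w) = p := by
  obtain ⟨x, y⟩ := p
  induction x using QuotientAddGroup.induction_on with | _ x =>
  induction y using QuotientAddGroup.induction_on with | _ y =>
  have hx := Int.fract_nonneg x
  have hy := Int.fract_nonneg y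
  have hx' := Int.fract_lt_one x
  have hy' := Int.fract_lt_one y
  have htorus : toTorus (Int.fract x, Int.fract y) = ((x : UnitAddCircle), (y : UnitAddCircle)) :=
    (toTorus_eq_iff (w := (x, y))).2 ⟨(⌊x⌋, ⌊y⌋), by simp [latticePoint]⟩
  rw [← htorus]
  rcases le_total (Int.fract x) (Int.fract y) with h | h
  · refine ⟨true, ![Int.fract y - Int.fract x, 1 - Int.fract y, Int.fract x], ⟨?_, ?_⟩, ?_⟩
    · simp [Fin.forall_fin_succ, h, hx, hy'.le]
    · simp [Fin.sum_univ_three]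
    · simp [planar_apply, Fin.sum_univ_three, cornerIndex, latticePoint]
  · refine ⟨false, ![Int.fract x - Int.fract y, Int.fract y, 1 - Int.fract x], ⟨?_, ?_⟩, ?_⟩
    · simp [Fin.forall_fin_succ, h, hy, hx'.le]
    · simp [Fin.sum_univ_three]
    · simp [planar_apply, Fin.sum_univ_three, cornerIndex, latticePoint]

/-- The face of a half of the unit square that corresponds to `cell`. -/
def planarCell (p : Bool × Finset (Fin 3)) : Set (ℝ × ℝ) :=
  convexHull ℝ ((fun i => latticePoint (cornerIndex p.1 i)) '' p.2)

lemma planarCell_eq (s : Bool) (J : Finset (Fin 3)) : planarCell (s, J) =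
    planar s '' convexHull ℝ ((fun i => Pi.single i (1 : ℝ)) '' (J : Set (Fin 3))) := by
  rw [LinearMap.image_convexHull, Set.image_image, planarCell]
  simp [planar, Fintype.linearCombination_apply_single]

lemma cell_eq (a b : ℕ) (s : Bool) (J : Finset (Fin 3)) : cell a b s J =
    spatial a b s '' convexHull ℝ ((fun i => Pi.single i (1 : ℝ)) '' (J : Set (Fin 3))) := by
  rw [LinearMap.image_convexHull, Set.image_image, cell]
  simp [spatial, Fintype.linearCombination_apply_single]

lemma squareTriangulation_eq (k : ℕ) : squareTriangulation k =
    (fun p => toTorus '' planarCell p) '' {p | p ∈ standardCells ∧ p.2.card = k + 1} := by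
  have hAD : toTorus '' segment ℝ (0, 1) (1, 1) = toTorus '' segment ℝ (0, 0) (1, 0) := by
    rw [← image_toTorus_translate (0, 1) (segment ℝ (0, 0) (1, 0)), segment_translate_image]
    simp [latticePoint]
  have himage {k : ℕ} {T : Finset (Bool × Finset (Fin 3))}
      (hT : standardCells.filter (fun p => p.2.card = k + 1) = T) :
      {p | p ∈ standardCells ∧ p.2.card = k + 1} = T := by
    rw [← hT, Finset.coe_filter]
  match k with
  | 0 =>
    rw [himage (T := {(true, {1})}) (by decide)]
    simp [squareTriangulation, planarCell, cornerIndex, latticePoint]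
  | 1 =>
    rw [himage (T := {(true, {0, 2}), (true, {0, 1}), (true, {1, 2})}) (by decide)]
    simp [squareTriangulation, planarCell, cornerIndex, latticePoint, Set.image_insert_eq,
      convexHull_pair, segment_symm ℝ ((0 : ℝ), (1 : ℝ)) (0, 0), hAD]
  | 2 =>
    rw [himage (T := {(true, Finset.univ), (false, Finset.univ)}) (by decide)]
    have huniv : ((Finset.univ : Finset (Fin 3)) : Set (Fin 3)) = {0, 1, 2} := by
      ext i
      fin_cases i <;> simp
    simp [squareTriangulation, planarCell, cornerIndex, latticePoint, Set.image_insert_eq, huniv,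
      -Finset.coe_univ, Set.pair_comm ((1 : ℝ), (1 : ℝ)), Set.insert_comm ((1 : ℝ), (0 : ℝ))]
  | k + 3 =>
    have hempty : {p ∈ standardCells | p.2.card = k + 3 + 1} = (∅ : Finset _) :=
      Finset.filter_false_of_mem fun p _ => by have := p.2.card_le_univ; simp at this; omega
    rw [himage hempty]
    simp [squareTriangulation]

namespace Roots

variable {a b : ℕ} (r : Roots a b)

/-- The image of a set in the factor of the sail. -/
def image (F : Set Space) : Set (SailFactor (frob a b) r.orth) :=
  Quotient.mk _ '' (Subtype.val ⁻¹' F)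

lemma image_unit_image {F : Set Space} (hF : F ⊆ sail r.orth) (κ : ℤ × ℤ) :
    r.image (toOperator (unit a b κ) '' F) = r.image F := by
  ext x
  constructor
  · rintro ⟨v, ⟨w, hw, h⟩, rfl⟩
    exact ⟨⟨w, hF hw⟩, hw, r.mk_eq_mk_iff.2 ⟨κ, h⟩⟩
  · rintro ⟨v, hv, rfl⟩
    exact ⟨⟨_, r.unit_mem_sail κ v.2⟩, ⟨v, hv, rfl⟩, (r.mk_eq_mk_iff.2 ⟨κ, rfl⟩).symm⟩

lemma torusTriangulation_eq (k : ℕ) : torusTriangulation (frob a b) r.orth k =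
    (fun p => r.image (cell a b p.1 p.2)) '' {p | p ∈ standardCells ∧ p.2.card = k + 1} := by
  have hcell (p : Bool × Finset (Fin 3)) : cell a b p.1 p.2 ⊆ sail r.orth :=
    (convexHull_mono (Set.image_mono (Finset.coe_subset.2 p.2.subset_univ))).trans
      (r.tri_subset_sail p.1)
  ext c
  constructor
  · rintro ⟨F, hF, rfl⟩
    obtain ⟨κ, p, hp, hk, rfl⟩ := r.isFace_iff_exists.1 hF
    exact ⟨p, ⟨hp, hk⟩, (r.image_unit_image (hcell p) κ).symm⟩
  · rintro ⟨p, ⟨hp, hk⟩, rfl⟩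
    exact ⟨_, r.isFace_iff_exists.2 ⟨0, p, hp, hk, (unit_zero_image _).symm⟩, rfl⟩

/-- The class of the point with given barycentric coordinates. -/
def factorPoint (p : Bool × stdSimplex ℝ (Fin 3)) : SailFactor (frob a b) r.orth :=
  Quotient.mk _ ⟨spatial a b p.1 p.2, r.tri_subset_sail p.1 (spatial_mem_tri p.1 p.2.2)⟩

lemma continuous_factorPoint : Continuous r.factorPoint := by
  refine continuous_quotient_mk'.comp (Continuous.subtype_mk ?_ _)
  exact continuous_prod_of_discrete_left.2 fun s =>
    (spatial a b s).continuous_of_finiteDimensional.comp continuous_subtype_val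

lemma surjective_factorPoint : Function.Surjective r.factorPoint := by
  intro x
  induction x using Quotient.inductionOn with | _ v =>
  obtain ⟨κ, s, h⟩ := r.exists_mem_tri v.2
  rw [tri, cell_eq] at h
  obtain ⟨w, hw, h⟩ := h
  exact ⟨(s, ⟨w, convexHull_image_single_subset_stdSimplex _ hw⟩),
    (r.mk_eq_mk_iff.2 ⟨κ, h.symm⟩).symm⟩

lemma exists_homeomorph : ∃ φ : SailFactor (frob a b) r.orth ≃ₜ UnitAddCircle × UnitAddCircle,
    ∀ p, φ (r.factorPoint p) = toTorus (planar p.1 p.2) := by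
  refine exists_homeomorph_of_fibres r.continuous_factorPoint ?_ r.surjective_factorPoint ?_ ?_
  · exact continuous_toTorus.comp (continuous_prod_of_discrete_left.2 fun s =>
      (planar s).continuous_of_finiteDimensional.comp continuous_subtype_val)
  · intro x
    obtain ⟨s, w, hw, h⟩ := exists_toTorus_planar x
    exact ⟨(s, ⟨w, hw⟩), h⟩
  · intro p q
    rw [factorPoint, factorPoint, mk_eq_mk_iff, toTorus_eq_iff]
    refine exists_congr fun κ => ?_
    exact (weights_eq_iff_spatial p.2.2 q.2.2).symm.trans (weights_eq_iff_planar p.2.2 q.2.2)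

lemma image_image_cell {φ : SailFactor (frob a b) r.orth ≃ₜ UnitAddCircle × UnitAddCircle}
    (hφ : ∀ p, φ (r.factorPoint p) = toTorus (planar p.1 p.2)) (p : Bool × Finset (Fin 3)) :
    φ '' r.image (cell a b p.1 p.2) = toTorus '' planarCell p := by
  obtain ⟨s, J⟩ := p
  rw [cell_eq, planarCell_eq]
  ext x
  constructor
  · rintro ⟨_, ⟨v, ⟨w, hw, h⟩, rfl⟩, rfl⟩
    refine ⟨_, ⟨w, hw, rfl⟩, ?_⟩
    refine (hφ (s, ⟨w, convexHull_image_single_subset_stdSimplex _ hw⟩)).symm.trans ?_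
    exact congrArg φ (congrArg (Quotient.mk _) (Subtype.ext h))
  · rintro ⟨_, ⟨w, hw, rfl⟩, rfl⟩
    exact ⟨_, ⟨_, ⟨w, hw, rfl⟩, rfl⟩,
      hφ (s, ⟨w, convexHull_image_single_subset_stdSimplex _ hw⟩)⟩

lemma homeomorphicDecompositions :
    HomeomorphicDecompositions (torusTriangulation (frob a b) r.orth) squareTriangulation := by
  obtain ⟨φ, hφ⟩ := r.exists_homeomorph
  refine ⟨φ, fun k => ?_⟩
  rw [torusTriangulation_eq, squareTriangulation_eq, Set.image_image]
  simp only [r.image_image_cell hφ]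

end Roots

section StandardFaces

variable (a b : ℕ)

/-- The faces of the sail among which each face of the sail has exactly one translate. -/
def standardFaces : Set (Set Space) :=
  (fun p : Bool × Finset (Fin 3) => cell a b p.1 p.2) '' standardCells

variable {a b}

lemma standardFaces_eq : standardFaces a b =
      {{ptB}, segment ℝ (ptA a) ptB, segment ℝ (ptA a) (ptD b), segment ℝ ptB (ptD b),
        convexHull ℝ {ptA a, ptB, ptD b}, convexHull ℝ {ptB, ptC a b, ptD b}} := by
  rw [← tri_true, ← tri_false]
  simp only [standardFaces, standardCells, Finset.coe_insert, Finset.coe_singleton,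
    Set.image_insert_eq, Set.image_singleton, tri]
  simp [cell, corner_true, Set.image_insert_eq, convexHull_pair]

lemma closure_openFaceUnion_standardFaces :
    closure (openFaceUnion (standardFaces a b)) = tri a b true ∪ tri a b false := by
  have hclosed : ∀ s, IsClosed (tri a b s) := fun s =>
    ((Set.toFinite _).isClosed_convexHull ℝ)
  have hmono : ∀ p : Bool × Finset (Fin 3), cell a b p.1 p.2 ⊆ tri a b p.1 := fun p =>
    convexHull_mono (Set.image_mono (by simp))
  have hclosure : ∀ s, tri a b s ⊆
      closure (openFaceUnion (standardFaces a b)) := fun s => by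
    have hmem : tri a b s ∈ standardFaces a b :=
      ⟨(s, Finset.univ), by cases s <;> decide, rfl⟩
    exact (subset_closure_intrinsicInterior (convex_convexHull ℝ _)).trans
      (closure_mono (Set.subset_biUnion_of_mem (u := fun F => intrinsicInterior ℝ F) hmem))
  refine Set.Subset.antisymm (closure_minimal ?_ ((hclosed _).union (hclosed _)))
    (Set.union_subset (hclosure _) (hclosure _))
  refine Set.iUnion₂_subset ?_
  rintro _ ⟨p, -, rfl⟩
  refine intrinsicInterior_subset.trans ((hmono p).trans ?_)
  cases p.1
  exacts [Set.subset_union_right, Set.subset_union_left]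

end StandardFaces

namespace Roots

variable {a b : ℕ} (r : Roots a b)

lemma isFundamentalFamily : IsFundamentalFamily (frob a b) r.orth (standardFaces a b) := by
  constructor
  · rintro _ ⟨p, hp, rfl⟩
    have hcard : ∀ p ∈ standardCells, p.2.card = p.2.card - 1 + 1 := by decide
    exact ⟨_, r.isFace_iff_exists.2 ⟨0, p, hp, hcard p hp, (unit_zero_image _).symm⟩⟩
  · intro k F hF
    obtain ⟨κ, p, hp, -, rfl⟩ := r.isFace_iff_exists.1 hF
    refine ⟨_, ⟨⟨p, hp, rfl⟩, _, r.mem_periodGroup_iff.2 ⟨-κ, rfl⟩, ?_⟩, ?_⟩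
    · rw [unit_image_unit_image, neg_add_cancel, unit_zero_image]
    · rintro _ ⟨⟨q, hq, rfl⟩, g, hg, h⟩
      obtain ⟨l, rfl⟩ := r.mem_periodGroup_iff.1 hg
      rw [unit_image_unit_image] at h
      rw [eq_of_unit_image_cell_eq hp hq h]

lemma isFace_vert (κ : ℤ × ℤ) : IsFace r.orth 0 {vert a b κ} :=
  r.isFace_iff_exists.2 ⟨κ, (true, {1}), by decide, rfl, vert_singleton κ⟩

end Roots

/-! ### Integer volumes of simplices -/

lemma IsIntegerPoint.exists_linForm_eq {v : Space} (hv : IsIntegerPoint v) (x y z : ℤ) :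
    ∃ k : ℤ, linForm x y z v = k := by
  choose p hp using hv
  exact ⟨x * p 0 + y * p 1 + z * p 2, by rw [linForm_apply, hp, hp, hp]; push_cast; rfl⟩

section Combination

variable {E : Type*} [NormedAddCommGroup E] [InnerProductSpace ℝ E] {k : ℕ}

/-- The linear map of the coordinate space that sends the standard basis to the family `d`. Its
`normDet` is the volume of the parallelotope with the edges `d`. -/
def combination (d : Fin k → E) : EuclideanSpace ℝ (Fin k) →ₗ[ℝ] E :=
  Fintype.linearCombination ℝ d ∘ₗ (WithLp.linearEquiv 2 ℝ (Fin k → ℝ)).toLinearMap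

lemma combination_apply (d : Fin k → E) (x : EuclideanSpace ℝ (Fin k)) :
    combination d x = ∑ i, x i • d i := rfl

lemma normDet_combination_pos {d : Fin k → E} :
    0 < (combination d).normDet ↔ LinearIndependent ℝ d := by
  rw [(LinearMap.normDet_nonneg _).lt_iff_ne', ne_eq, LinearMap.normDet_eq_zero_iff_ker_ne_bot,
    not_ne_iff, LinearMap.ker_eq_bot, linearIndependent_iff_injective_fintypeLinearCombination]
  exact (WithLp.equiv 2 (Fin k → ℝ)).injective_comp (Fintype.linearCombination ℝ d)

lemma normDet_combination_matrix (d : Fin k → E) (A : Matrix (Fin k) (Fin k) ℝ) :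
    (combination fun i => ∑ j, A i j • d j).normDet = |A.det| * (combination d).normDet := by
  have e : (combination fun i => ∑ j, A i j • d j) =
      combination d ∘ₗ Matrix.toEuclideanLin A.transpose := by
    ext1 x
    simp only [LinearMap.comp_apply, combination_apply, Matrix.toLpLin_apply, Matrix.mulVec,
      dotProduct, Matrix.transpose_apply, Finset.smul_sum, Finset.sum_smul]
    rw [Finset.sum_comm]
    simp only [smul_smul, mul_comm]
  rw [e, LinearMap.normDet_comp_of_finrank_eq _ _ rfl, LinearMap.normDet_eq_abs_det,
    Matrix.toEuclideanLin_eq_toLin_orthonormal, LinearMap.det_toLin, Matrix.det_transpose, mul_comm]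

end Combination

/-- The vertices of the standard simplex. -/
def standardVertex (k : ℕ) : Fin (k + 1) → EuclideanSpace ℝ (Fin k) :=
  Fin.cons 0 fun i => EuclideanSpace.single i 1

/-- The volume `1 / k!` of the standard simplex; only its positivity matters. -/
def standardVolume (k : ℕ) : ℝ := (volume (convexHull ℝ (Set.range (standardVertex k)))).toReal

lemma standardVolume_pos (k : ℕ) : 0 < standardVolume k := by
  have hind : AffineIndependent ℝ (standardVertex k) := by
    rw [affineIndependent_iff_linearIndependent_sub]
    have hbasis : (fun i : Fin k => standardVertex k i.succ - standardVertex k 0) =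
        (EuclideanSpace.basisFun (Fin k) ℝ).toBasis := by
      ext i
      simp [standardVertex]
    exact hbasis ▸ (EuclideanSpace.basisFun (Fin k) ℝ).toBasis.linearIndependent
  refine ENNReal.toReal_pos (Measure.measure_pos_of_nonempty_interior _ ?_).ne'
    ((Set.finite_range _).isCompact_convexHull ℝ).measure_lt_top.ne
  rw [interior_convexHull_nonempty_iff_affineSpan_eq_top,
    hind.affineSpan_eq_top_iff_card_eq_finrank_add_one]
  simp

lemma euclideanVolume_simplex {k : ℕ} (w : Fin (k + 1) → Space) :
    euclideanVolume k (convexHull ℝ (Set.range w)) =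
      (combination fun i : Fin k => w i.succ - w 0).normDet * standardVolume k := by
  set f := combination fun i : Fin k => w i.succ - w 0
  have hsimplex : convexHull ℝ (Set.range w) =
      (fun v => w 0 + v) '' (f '' convexHull ℝ (Set.range (standardVertex k))) := by
    rw [LinearMap.image_convexHull, ← Set.range_comp,
      show (fun v => w 0 + v) = (AffineEquiv.constVAdd ℝ Space (w 0)).toAffineMap from rfl,
      AffineMap.image_convexHull, ← Set.range_comp]
    congr 2
    ext1 i
    refine Fin.cases ?_ (fun i => ?_) i <;> simp [standardVertex, f, combination_apply]
  have hvolume := f.euclideanHausdorffMeasure_image_eq_normDet_mul_volume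
    (convexHull ℝ (Set.range (standardVertex k)))
  rw [finrank_euclideanSpace_fin] at hvolume
  rw [euclideanVolume, hsimplex, (isometry_add_left (w 0)).euclideanHausdorffMeasure_image, hvolume,
    ENNReal.toReal_mul, ENNReal.toReal_ofReal (LinearMap.normDet_nonneg _), standardVolume]

/-- The family `d` is a basis of the lattice of the integer points in its real span. -/
structure IsLatticeBasis {k : ℕ} (d : Fin k → Space) : Prop where
  linearIndependent : LinearIndependent ℝ d
  isIntegerPoint : ∀ i, IsIntegerPoint (d i)
  exists_eq_sum : ∀ v ∈ Submodule.span ℝ (Set.range d), IsIntegerPoint v →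
    ∃ z : Fin k → ℤ, v = ∑ j, (z j : ℝ) • d j

namespace IsLatticeBasis

variable {k : ℕ} {d : Fin k → Space}

lemma of_biorthogonal {c : Fin k → Space →ₗ[ℝ] ℝ} (hd : ∀ i, IsIntegerPoint (d i))
    (hc : ∀ i v, IsIntegerPoint v → ∃ z : ℤ, c i v = z)
    (hcd : ∀ i j, c i (d j) = if i = j then 1 else 0) : IsLatticeBasis d := by
  have hsum : ∀ (x : Fin k → ℝ) i, c i (∑ j, x j • d j) = x i := fun x i => by simp [hcd]
  refine ⟨Fintype.linearIndependent_iff.2 fun x hx i => ?_, hd, fun v hv hi => ?_⟩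
  · rw [← hsum x i, hx, map_zero]
  · obtain ⟨x, rfl⟩ := (Submodule.mem_span_range_iff_exists_fun ℝ).1 hv
    choose z hz using fun i => hc i _ hi
    exact ⟨z, by simp only [← hz, hsum]⟩

variable (hd : IsLatticeBasis d)
include hd

lemma normDet_mul_standardVolume_le {w : Fin (k + 1) → Space} (hw : AffineIndependent ℝ w)
    (hi : ∀ i, IsIntegerPoint (w i))
    (hspan : ∀ i : Fin k, w i.succ - w 0 ∈ Submodule.span ℝ (Set.range d)) :
    (combination d).normDet * standardVolume k ≤
      euclideanVolume k (convexHull ℝ (Set.range w)) := by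
  choose z hz using fun i => hd.exists_eq_sum _ (hspan i) ((hi _).sub (hi _))
  let Z : Matrix (Fin k) (Fin k) ℤ := Matrix.of z
  have hdet := normDet_combination_matrix d (Z.map (Int.cast : ℤ → ℝ))
  rw [show (fun i => ∑ j, Z.map (Int.cast : ℤ → ℝ) i j • d j) = fun i => w i.succ - w 0 from
    (funext hz).symm, ← Int.cast_det] at hdet
  have hZ : Z.det ≠ 0 := fun h => by
    have hpos := normDet_combination_pos.2 ((affineIndependent_iff_linearIndependent_sub w).1 hw)
    simp [hdet, h] at hpos
  rw [euclideanVolume_simplex, hdet]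
  refine mul_le_mul_of_nonneg_right (le_mul_of_one_le_left (LinearMap.normDet_nonneg _) ?_)
    (standardVolume_pos k).le
  exact_mod_cast Int.one_le_abs hZ

lemma sInf_euclideanVolume {H : AffineSubspace ℝ Space} {p : Space} (hp : IsIntegerPoint p)
    (hpH : p ∈ H) (hH : H.direction = Submodule.span ℝ (Set.range d)) :
    sInf {V | ∃ w : Fin (k + 1) → Space, AffineIndependent ℝ w ∧
      (∀ i, IsIntegerPoint (w i) ∧ w i ∈ H) ∧
      V = euclideanVolume k (convexHull ℝ (Set.range w))} =
        (combination d).normDet * standardVolume k := by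
  refine IsLeast.csInf_eq ⟨⟨Fin.cons p fun i => d i + p, ?_, ?_, ?_⟩, ?_⟩
  · rw [affineIndependent_iff_linearIndependent_sub]
    simpa using hd.linearIndependent
  · refine Fin.cases ⟨hp, hpH⟩ fun i => ⟨(hd.isIntegerPoint i).add hp, ?_⟩
    exact AffineSubspace.vadd_mem_of_mem_direction
      (hH ▸ Submodule.subset_span (Set.mem_range_self i)) hpH
  · rw [euclideanVolume_simplex]
    simp
  · rintro _ ⟨w, hw, hi, rfl⟩
    refine hd.normDet_mul_standardVolume_le hw (fun i => (hi i).1) fun i => ?_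
    exact hH ▸ AffineSubspace.vsub_mem_direction (hi _).2 (hi _).2

lemma integerVolume_simplex {w : Fin (k + 1) → Space} {A : Matrix (Fin k) (Fin k) ℤ}
    (hA : A.det ≠ 0) (hw : IsIntegerPoint (w 0))
    (hwd : ∀ i : Fin k, w i.succ - w 0 = ∑ j, (A i j : ℝ) • d j) :
    integerVolume k (convexHull ℝ (Set.range w)) = |(A.det : ℝ)| := by
  have hpos := normDet_combination_pos.2 hd.linearIndependent
  have hdet := normDet_combination_matrix d (A.map (Int.cast : ℤ → ℝ))
  rw [show (fun i => ∑ j, A.map (Int.cast : ℤ → ℝ) i j • d j) = fun i => w i.succ - w 0 from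
    (funext hwd).symm, ← Int.cast_det] at hdet
  have hindep : AffineIndependent ℝ w := by
    rw [affineIndependent_iff_linearIndependent_sub, ← normDet_combination_pos, hdet]
    exact mul_pos (abs_pos.2 (Int.cast_ne_zero.2 hA)) hpos
  have hspan : vectorSpan ℝ (Set.range w) = Submodule.span ℝ (Set.range d) := by
    refine Submodule.eq_of_le_of_finrank_eq ?_ ?_
    · rw [vectorSpan_range_eq_span_range_vsub_right ℝ w 0, Submodule.span_le]
      rintro _ ⟨i, rfl⟩
      refine Fin.cases (by simp) (fun i => ?_) i
      simp only [vsub_eq_sub, hwd]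
      exact Submodule.sum_mem _ fun j _ =>
        Submodule.smul_mem _ _ (Submodule.subset_span ⟨j, rfl⟩)
    · rw [hindep.finrank_vectorSpan (n := k) (by simp),
        finrank_span_eq_card hd.linearIndependent, Fintype.card_fin]
  rw [integerVolume, affineSpan_convexHull,
    hd.sInf_euclideanVolume hw (mem_affineSpan ℝ (Set.mem_range_self 0))
      ((direction_affineSpan ℝ _).trans hspan), euclideanVolume_simplex, hdet, mul_assoc,
    mul_div_cancel_right₀ _ (mul_pos hpos (standardVolume_pos k)).ne']

end IsLatticeBasis

/-! ### Integer lengths, areas and distances of the faces -/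

lemma integerLength_eq {P Q d : Space} {n : ℤ} (x y z : ℤ) (hn : n ≠ 0) (hP : IsIntegerPoint P)
    (hd : IsIntegerPoint d) (hform : linForm x y z d = 1) (hQ : Q - P = (n : ℝ) • d) :
    integerLength P Q = |(n : ℝ)| := by
  have hbasis : IsLatticeBasis fun _ : Fin 1 => d :=
    .of_biorthogonal (c := fun _ => linForm x y z) (fun _ => hd)
      (fun _ _ hv => hv.exists_linForm_eq x y z)
      (fun i j => by rw [hform, if_pos (Subsingleton.elim i j)])
  have hvolume := hbasis.integerVolume_simplex (w := ![P, Q]) (A := !![n]) (by simpa using hn) hP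
    (by simpa using hQ)
  rw [Matrix.det_fin_one_of] at hvolume
  rw [integerLength, ← convexHull_pair, ← hvolume, Matrix.range_cons_cons_empty]

lemma integerLength_eq_one {P Q : Space} (x y z : ℤ) (hP : IsIntegerPoint P)
    (hQ : IsIntegerPoint Q) (hform : linForm x y z (Q - P) = 1) : integerLength P Q = 1 := by
  simpa using integerLength_eq (n := 1) x y z one_ne_zero hP (hQ.sub hP) hform (by simp)

lemma integerArea_eq {P Q R d : Space} {n : ℤ} (x y z x' y' z' : ℤ) (hn : n ≠ 0)
    (hP : IsIntegerPoint P) (hQ : IsIntegerPoint Q) (hd : IsIntegerPoint d)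
    (hR : R - P = (n : ℝ) • d) (hformQ : linForm x y z (Q - P) = 1) (hformd : linForm x y z d = 0)
    (hformQ' : linForm x' y' z' (Q - P) = 0) (hformd' : linForm x' y' z' d = 1) :
    integerArea P Q R = |(n : ℝ)| := by
  have hbasis : IsLatticeBasis ![Q - P, d] :=
    .of_biorthogonal (c := ![linForm x y z, linForm x' y' z'])
      (Fin.forall_fin_two.2 ⟨hQ.sub hP, hd⟩)
      (Fin.forall_fin_two.2 ⟨fun _ hv => hv.exists_linForm_eq x y z,
        fun _ hv => hv.exists_linForm_eq x' y' z'⟩)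
      (by simp [Fin.forall_fin_two, -map_sub, hformQ, hformd, hformQ', hformd'])
  have hvolume := hbasis.integerVolume_simplex (w := ![P, Q, R]) (A := !![1, 0; 0, n])
    (by simpa [Matrix.det_fin_two_of] using hn) hP (by simp [Fin.forall_fin_two, hR])
  rw [Matrix.det_fin_two_of, one_mul, mul_zero, sub_zero] at hvolume
  rw [integerArea, ← hvolume, Matrix.range_cons, Matrix.range_cons_cons_empty, Set.singleton_union]

section Faces

variable (a b : ℕ)

lemma isIntegerPoint_ptA : IsIntegerPoint (ptA a) :=
  vert_zero_one (a := a) (b := 0) ▸ isIntegerPoint_vert _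

lemma isIntegerPoint_ptB : IsIntegerPoint ptB :=
  vert_zero (a := 0) (b := 0) ▸ isIntegerPoint_vert _

lemma isIntegerPoint_ptC : IsIntegerPoint (ptC a b) := vert_one_zero ▸ isIntegerPoint_vert _

lemma isIntegerPoint_ptD : IsIntegerPoint (ptD b) :=
  vert_one_one (a := 0) (b := b) ▸ isIntegerPoint_vert _

/-- The vector from each point of the edge `BD` with integer coordinates to the next one. -/
def stepBD : Space := !₂[(b : ℝ) + 1, 1, 0]

lemma isIntegerPoint_stepBD : IsIntegerPoint (stepBD b) := fun i =>
  match i with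
  | 0 => ⟨b + 1, by simp [stepBD]⟩
  | 1 => ⟨1, by simp [stepBD]⟩
  | 2 => ⟨0, by simp [stepBD]⟩

lemma ptD_sub_ptB : ptD b - ptB = ((b + 1 : ℤ) : ℝ) • stepBD b := by
  apply space_ext <;> simp [ptD, ptB, stepBD, sq]

lemma integerLength_AB : integerLength (ptA a) ptB = 1 :=
  integerLength_eq_one (-1) 0 0 (isIntegerPoint_ptA a) isIntegerPoint_ptB
    (by simp [linForm_apply, ptA, ptB])

lemma integerLength_BC : integerLength ptB (ptC a b) = 1 :=
  integerLength_eq_one 0 1 0 isIntegerPoint_ptB (isIntegerPoint_ptC a b)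
    (by simp [linForm_apply, ptB, ptC])

lemma integerLength_CD : integerLength (ptC a b) (ptD b) = 1 :=
  integerLength_eq_one 0 0 1 (isIntegerPoint_ptC a b) (isIntegerPoint_ptD b)
    (by simp [linForm_apply, ptC, ptD])

lemma integerLength_DA : integerLength (ptD b) (ptA a) = 1 :=
  integerLength_eq_one (a + 2) (-(a + 2) * (b + 1)) (-1) (isIntegerPoint_ptD b)
    (isIntegerPoint_ptA a) (by simp [linForm_apply, ptD, ptA]; ring)

lemma abs_intCast_add_one : |((b + 1 : ℤ) : ℝ)| = b + 1 := by
  push_cast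
  exact abs_of_pos (by positivity)

lemma integerLength_BD : integerLength ptB (ptD b) = b + 1 := by
  rw [integerLength_eq 0 1 0 (by positivity) isIntegerPoint_ptB (isIntegerPoint_stepBD b)
    (by simp [linForm_apply, stepBD]) (ptD_sub_ptB b), abs_intCast_add_one]

lemma integerArea_ABD : integerArea (ptA a) ptB (ptD b) = b + 1 := by
  have hcomm : integerArea (ptA a) ptB (ptD b) = integerArea ptB (ptA a) (ptD b) := by
    rw [integerArea, integerArea, Set.insert_comm]
  rw [hcomm, integerArea_eq 1 (-(b + 1)) 0 0 1 0 (by positivity) isIntegerPoint_ptB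
    (isIntegerPoint_ptA a) (isIntegerPoint_stepBD b) (ptD_sub_ptB b), abs_intCast_add_one]
  all_goals simp [linForm_apply, ptA, ptB, stepBD]

lemma integerArea_BCD : integerArea ptB (ptC a b) (ptD b) = b + 1 := by
  rw [integerArea_eq 0 0 (-1) 0 1 1 (by positivity) isIntegerPoint_ptB
    (isIntegerPoint_ptC a b) (isIntegerPoint_stepBD b) (ptD_sub_ptB b), abs_intCast_add_one]
  all_goals simp [linForm_apply, ptB, ptC, stepBD]

end Faces

lemma linForm_eq_inner (x y z : ℝ) (v : Space) : linForm x y z v = inner ℝ !₂[x, y, z] v := by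
  simp [linForm_apply, PiLp.inner_apply, Fin.sum_univ_three, mul_comm]

lemma integerDistance_zero_eq {H : AffineSubspace ℝ Space} {x y z c : ℤ}
    (hH : ∀ v, v ∈ H ↔ linForm x y z v = c) {v : Space} (hv : IsIntegerPoint v)
    (hform : linForm x y z v = 1) : integerDistance H 0 = |(c : ℝ)| := by
  set n : Space := !₂[(x : ℝ), (y : ℝ), (z : ℝ)]
  have hn : n ≠ 0 := fun h0 => by
    rw [linForm_eq_inner, show !₂[(x : ℝ), (y : ℝ), (z : ℝ)] = 0 from h0, inner_zero_left] at hform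
    exact zero_ne_one hform
  have hdist : ∀ q, Metric.infDist q (H : Set Space) = |linForm x y z q - c| / ‖n‖ := fun q => by
    rw [linForm_eq_inner]
    exact infDist_eq_abs_inner_sub_div_norm hn (fun v => by rw [← linForm_eq_inner, ← hH]; rfl) q
  have hmin : sInf {d | ∃ q, IsIntegerPoint q ∧ q ∉ H ∧ d = Metric.infDist q (H : Set Space)} =
      1 / ‖n‖ := by
    have hnext : linForm x y z (((c + 1 : ℤ) : ℝ) • v) = c + 1 := by
      rw [map_smul, hform]
      simp
    refine IsLeast.csInf_eq ⟨⟨((c + 1 : ℤ) : ℝ) • v, hv.smul _, ?_, ?_⟩, ?_⟩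
    · rw [hH, hnext]
      simp
    · rw [hdist, hnext]
      simp
    · rintro _ ⟨q, hq, hqH, rfl⟩
      obtain ⟨k, hk⟩ := hq.exists_linForm_eq x y z
      rw [hH, hk, Int.cast_inj] at hqH
      rw [hdist, hk]
      gcongr
      exact_mod_cast Int.one_le_abs (sub_ne_zero.2 hqH)
  rw [integerDistance, hmin, hdist, map_zero, zero_sub, abs_neg,
    div_div_div_cancel_right₀ (norm_ne_zero_iff.2 hn), div_one]

lemma mem_affineSpan_corner_iff {a b : ℕ} {s : Bool} {v : Space} :
    v ∈ affineSpan ℝ (Set.range (corner a b s)) ↔ triFun a b s v = 1 := by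
  constructor
  · intro hv
    obtain ⟨w, hw, rfl⟩ := eq_affineCombination_of_mem_affineSpan_of_fintype hv
    rw [Finset.affineCombination_eq_linear_combination _ _ _ hw, map_sum]
    simpa [triFun_corner] using hw
  · intro hv
    rw [triFun_apply] at hv
    rw [← sum_bar_smul_corner s v,
      ← Finset.affineCombination_eq_linear_combination _ _ _ hv]
    exact affineCombination_mem_affineSpan hv _

section Faces

variable (a b : ℕ)

lemma integerDistance_ABD : integerDistance (affineSpan ℝ {ptA a, ptB, ptD b}) 0 = 1 := by
  have hrange : ({ptA a, ptB, ptD b} : Set Space) = Set.range (corner a b true) := by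
    rw [corner_true, Matrix.range_cons, Matrix.range_cons_cons_empty, Set.singleton_union]
  rw [hrange, integerDistance_zero_eq (x := -(a + 1)) (y := (a + 1) * (b + 1)) (z := 1) (c := 1)
    (fun v => ?_) isIntegerPoint_ptB (by simp [linForm_apply, ptB])]
  · simp
  · rw [mem_affineSpan_corner_iff, triFun_true, linForm_apply]
    push_cast
    rw [one_mul]

lemma integerDistance_BCD : integerDistance (affineSpan ℝ {ptB, ptC a b, ptD b}) 0 = a + 2 := by
  have hrange : ({ptB, ptC a b, ptD b} : Set Space) = Set.range (corner a b false) := by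
    rw [corner_false, Matrix.range_cons, Matrix.range_cons_cons_empty, Set.singleton_union,
      Set.insert_comm, Set.pair_comm ptB]
  have ha : (a : ℝ) + 2 ≠ 0 := by positivity
  rw [hrange, integerDistance_zero_eq (x := -1) (y := b + 1) (z := a + 2) (c := a + 2) (fun v => ?_)
    ((isIntegerPoint_ptB.smul (a + 2)).sub (isIntegerPoint_ptA a))
    (by simp [linForm_apply, ptB, ptA])]
  · push_cast
    exact abs_of_pos (by positivity)
  · rw [mem_affineSpan_corner_iff, triFun_false, linForm_apply, div_eq_one_iff_eq ha]
    push_cast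
    rw [neg_one_mul]

lemma integerPoints_openSegment_ptB_ptD :
    {x | x ∈ openSegment ℝ ptB (ptD b) ∧ IsIntegerPoint x} =
      {x | ∃ i : ℕ, 1 ≤ i ∧ i ≤ b ∧ x = !₂[((b : ℝ) + 1) * i, (i : ℝ), 1]} := by
  have hb : (0 : ℝ) < b + 1 := by positivity
  ext x
  rw [openSegment_eq_image']
  constructor
  · rintro ⟨⟨t, ⟨ht0, ht1⟩, rfl⟩, hx⟩
    obtain ⟨k, hk⟩ := hx 1
    replace hk : t * (b + 1) = k := by simpa [ptB, ptD] using hk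
    have h0 : 0 < k := by exact_mod_cast hk ▸ mul_pos ht0 hb
    have h1 : k < b + 1 := by exact_mod_cast hk ▸ mul_lt_of_lt_one_left hb ht1
    lift k to ℕ using h0.le
    refine ⟨k, by omega, by omega, ?_⟩
    push_cast at hk
    apply space_ext <;> simp [ptB, ptD, ← hk]
    ring
  · rintro ⟨i, h1, h2, rfl⟩
    have hi : (0 : ℝ) < i := by exact_mod_cast h1
    have hi' : (i : ℝ) < b + 1 := by exact_mod_cast Nat.lt_succ_of_le h2
    refine ⟨⟨i / (b + 1), ⟨by positivity, (div_lt_one hb).2 hi'⟩, ?_⟩, fun j => ?_⟩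
    · apply space_ext <;> simp [ptB, ptD] <;> field_simp
    · match j with
      | 0 => exact ⟨(b + 1) * i, by simp⟩
      | 1 => exact ⟨i, by simp⟩
      | 2 => exact ⟨1, by simp⟩

end Faces

end KleinPolyhedron

end

theorem proposition3p1 (a b : ℕ) (m n : ℤ) (hm : m = b - a - 1) (hn : n = (a + 2) * (b + 1))
    (M : SL(3, ℤ)) (hM : M = frobeniusOperator m n)
    (A B C D : Space) (hA : A = !₂[1, 0, (a : ℝ) + 2]) (hB : B = !₂[0, 0, 1])
    (hC : C = !₂[(b : ℝ) - a - 1, 1, 0]) (hD : D = !₂[((b : ℝ) + 1) ^ 2, (b : ℝ) + 1, 1])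
    (𝓕 : Set (Set Space))
    (h𝓕 : 𝓕 = {{B}, segment ℝ A B, segment ℝ A D, segment ℝ B D,
      convexHull ℝ {A, B, D}, convexHull ℝ {B, C, D}}) :
    -- the operator defines a continued fraction of a cubic irrationality
    (Irreducible ((M : Matrix (Fin 3) (Fin 3) ℤ).map (Int.cast : ℤ → ℚ)).charpoly ∧
      ∃ r : Fin 3 → ℝ, Function.Injective r ∧
        ∀ i, Module.End.HasEigenvalue (toOperator M) (r i)) ∧
    -- the sail in question, that of the only orthant whose hull contains `(0, 0, 1)`
    ∃ O : Set Space, (IsOrthant M O ∧ B ∈ integerHull O) ∧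
      (∀ O' : Set Space, IsOrthant M O' → B ∈ integerHull O' → O' = O) ∧
      -- the homeomorphic type of the torus triangulation
      HomeomorphicDecompositions (torusTriangulation M O) squareTriangulation ∧
      -- the period group is free abelian with the generators `X` and `Y`
      (∃ X Y : SL(3, ℤ), X = M⁻¹ ^ 2 ∧
        (Y : Matrix (Fin 3) (Fin 3) ℤ) =
          (M⁻¹ : SL(3, ℤ)) *
            (((M⁻¹ : SL(3, ℤ)) : Matrix (Fin 3) (Fin 3) ℤ) - ((b : ℤ) + 1) • 1) ∧
        X * Y = Y * X ∧
        periodGroup M O = Subgroup.closure {X, Y} ∧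
        (∀ i j : ℤ, X ^ i * Y ^ j = 1 → i = 0 ∧ j = 0) ∧
        toOperator X A = D ∧ toOperator X B = C ∧
        toOperator Y A = B ∧ toOperator Y D = C) ∧
      -- the points `A`, `B`, `C`, `D` are vertices of the sail
      (IsFace O 0 {A} ∧ IsFace O 0 {B} ∧ IsFace O 0 {C} ∧ IsFace O 0 {D}) ∧
      -- a fundamental region and its closure
      (IsFundamentalFamily M O 𝓕 ∧ IsFundamentalRegion M O (openFaceUnion 𝓕) ∧
        closure (openFaceUnion 𝓕) = convexHull ℝ {A, B, D} ∪ convexHull ℝ {B, C, D}) ∧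
      -- the integer points inside the segment `BD`
      {x | x ∈ openSegment ℝ B D ∧ IsIntegerPoint x} =
        {x | ∃ i : ℕ, 1 ≤ i ∧ i ≤ b ∧ x = !₂[((b : ℝ) + 1) * i, (i : ℝ), 1]} ∧
      -- integer lengths, areas and distances
      (integerLength A B = 1 ∧ integerLength B C = 1 ∧ integerLength C D = 1 ∧
        integerLength D A = 1 ∧ integerLength B D = b + 1) ∧
      (integerArea A B D = b + 1 ∧ integerArea B C D = b + 1) ∧
      (integerDistance (affineSpan ℝ {A, B, D}) 0 = 1 ∧
        integerDistance (affineSpan ℝ {B, C, D}) 0 = a + 2) := by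
  obtain ⟨r⟩ := Roots.exists a b
  obtain rfl : M = frob a b := by rw [hM, hm, hn, frob]
  obtain rfl : A = ptA a := hA
  obtain rfl : B = ptB := hB
  obtain rfl : C = ptC a b := hC
  obtain rfl : D = ptD b := hD
  obtain rfl : 𝓕 = standardFaces a b := h𝓕.trans standardFaces_eq.symm
  refine ⟨⟨irreducible_charpoly_frob, exists_eigenvalues a b⟩, r.orth,
    ⟨r.isOrthant_orth, vert_zero ▸ r.vert_mem_integerHull 0⟩, fun O' => r.eq_orth,
    r.homeomorphicDecompositions,
    ⟨unitX a b, unitY a b, rfl, unitY_coe, commute_unitX_unitY, r.periodGroup_eq_closure,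
      fun i j => eq_zero_of_unitX_zpow_mul_unitY_zpow,
      unitX_ptA, unitX_ptB, unitY_ptA, unitY_ptD⟩,
    ⟨vert_zero_one ▸ r.isFace_vert (0, 1), vert_zero ▸ r.isFace_vert 0,
      vert_one_zero ▸ r.isFace_vert (1, 0), vert_one_one ▸ r.isFace_vert (1, 1)⟩,
    ⟨r.isFundamentalFamily, ⟨_, r.isFundamentalFamily, rfl⟩, ?_⟩,
    integerPoints_openSegment_ptB_ptD b,
    ⟨integerLength_AB a, integerLength_BC a b, integerLength_CD a b, integerLength_DA a b,
      integerLength_BD b⟩, ⟨integerArea_ABD a b, integerArea_BCD a b⟩,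
    integerDistance_ABD a b, integerDistance_BCD a b⟩
  rw [closure_openFaceUnion_standardFaces, tri_true, tri_false]
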